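/- **Theorem 5.3.** Let $\mathsf C$ and $\mathsf D$ be small categories, let $P\colon \mathsf C^{\mathrm{op}}\times \mathsf D\to \mathrm{Set}$ be a profunctor, and let $A$ be an abelian group. An element $\varphi\in P(c,d)$ is written $\varphi\colon c\rightsquigarrow d$. *Notation.* For a small category $\mathsf E$ and a contravariant functor $G\colon \mathsf E^{\mathrm{op}}\to \mathrm{Ab}$, $H_n(\mathsf E,G)$ is the $n$-th homology of the chain complex with $C_n(\mathsf E,G)=\bigoplus_{e_0\to\cdots\to e_n}G(e_n)$ and boundary $\sum_i(-1)^i\varepsilon_i$, where $\varepsilon_i$ sends the summand of $e_0\to\cdots\to e_n$ to the summand of the string with $e_i$ omitted, by the identity if $i<n$ and by $G(e_{n-1}\to e_n)$ if $i=n$; $H_n(\mathsf E)$ denotes the homology with constant coefficients $A$. For $c\in\mathsf C$ let $P(c,\mathsf D)$ be the category whose objects are the $\varphi\colon c\rightsquigarrow d$ with $d\in\mathsf D$ and whose morphisms from $\varphi\colon c\rightsquigarrow d$ to $\varphi'\colon c\rightsquigarrow d'$ are the $g\colon d\to d'$ with $g\varphi=\varphi'$. For $d\in\mathsf D$ let $P(\mathsf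 C,d)$ be the category whose objects are the $\varphi\colon c\rightsquigarrow d$ with $c\in\mathsf C$ and whose morphisms from $\varphi\colon c\rightsquigarrow d$ to $\varphi'\colon c'\rightsquigarrow d$ are the $f\colon c\to c'$ with $\varphi' f=\varphi$. Let $\mathcal F^q_{\mathsf C}\colon \mathsf C^{\mathrm{op}}\to\mathrm{Ab}$, $c\mapsto H_q(P(c,\mathsf D))$, and $\mathcal F^p_{\mathsf D}\colon \mathsf D\to\mathrm{Ab}$, $d\mapsto H_p(P(\mathsf C,d))$, be the induced functors. Let $C_{\bullet,\bullet}$ be the double complex with $C_{p,q}=\bigoplus_\lambda A$ ($p,q\ge 0$), the sum over all $$\lambda\colon\; c_0\to\cdots\to c_p\rightsquigarrow d_0\to\cdots\to d_q ,$$ whose differentials $C_{p,q}\to C_{p-1,q}$ and $C_{p,q}\to C_{p,q-1}$ are the alternating sums of the maps that omit $c_i$ ($0\le i\le p$), respectively $d_j$ ($0\le j\le q$), from $\lambda$, composing the two adjacent arrows where there are two. Let $\mathrm{Tot}$ be its total complex. *Claim.* There are first quadrant spectral sequences $E^{\mathsf C}$ and $E^{\mathsf D}$ with $$E^{\mathsf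 C,2}_{p,q}\cong H_p(\mathsf C,\mathcal F^q_{\mathsf C}),\qquad E^{\mathsf D,2}_{p,q}\cong H_q(\mathsf D^{\mathrm{op}},\mathcal F^p_{\mathsf D})\qquad(p,q\ge 0),$$ with differentials $d^r\colon E^{\mathsf C,r}_{p,q}\to E^{\mathsf C,r}_{p-r,q+r-1}$ and $d^r\colon E^{\mathsf D,r}_{p,q}\to E^{\mathsf D,r}_{p+r-1,q-r}$. They are the spectral sequences of $\mathrm{Tot}$ filtered by $p$, respectively by $q$, and both converge to $H_{p+q}(\mathrm{Tot})$: $E^{\mathsf C,\infty}_{p,q}$ and $E^{\mathsf D,\infty}_{p,q}$ are isomorphic to the $p$-th, respectively $q$-th, graded piece of $H_{p+q}(\mathrm{Tot})$ for the filtration induced by $p$, respectively by $q$; these filtrations of $H_n(\mathrm{Tot})$ are increasing, are zero in degree $-1$ and are all of $H_n(\mathrm{Tot})$ in degree $n$. -/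

import Mathlib

open CategoryTheory Opposite

universe u

/-! ### Homology of small categories -/

namespace SmallCat

/-- The reindexing of a string `c_0 ⟶ ⋯ ⟶ c_m` along a simplicial operator. This is the
operator of the nerve. -/
def restrict {C : Type u} [SmallCategory C] {m m' : SimplexCategoryᵒᵖ} (α : m ⟶ m')
    (σ : ComposableArrows C m.unop.len) : ComposableArrows C m'.unop.len :=
  σ.whiskerLeft α.unop.toOrderHom.monotone.functor

/-- The arrow `σ (α last) ⟶ σ last`. -/
def toLast {C : Type u} [SmallCategory C] {m m' : SimplexCategoryᵒᵖ} (α : m ⟶ m')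
    (σ : ComposableArrows C m.unop.len) :
    (restrict α σ).obj (Fin.last m'.unop.len) ⟶ σ.obj (Fin.last m.unop.len) :=
  σ.map (homOfLE (Fin.le_last (α.unop.toOrderHom (Fin.last m'.unop.len))))

/-- The arrow `σ 0 ⟶ σ (α 0)`. -/
def fromZero {C : Type u} [SmallCategory C] {m m' : SimplexCategoryᵒᵖ} (α : m ⟶ m')
    (σ : ComposableArrows C m.unop.len) : σ.obj 0 ⟶ (restrict α σ).obj 0 :=
  σ.map (homOfLE (Fin.zero_le (α.unop.toOrderHom 0)))

/-- The summand `G (c_m)` belonging to a string `c_0 ⟶ ⋯ ⟶ c_m`. -/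
abbrev coeff {C : Type u} [SmallCategory C] (G : Cᵒᵖ ⥤ AddCommGrpCat.{u}) (m : SimplexCategoryᵒᵖ)
    (σ : ComposableArrows C m.unop.len) : AddCommGrpCat.{u} :=
  G.obj (op (σ.obj (Fin.last m.unop.len)))

/-- The simplicial abelian group of chains of a small category `C` with coefficients in a
contravariant functor `G : Cᵒᵖ ⥤ Ab`. In degree `n` it is the direct sum of the groups `G (c_n)` over
all strings `c_0 ⟶ ⋯ ⟶ c_n`. A simplicial operator `α` sends the summand of `σ` to the summand of
`σ ∘ α` by the map that `G` induces from the arrow `σ (α last) ⟶ σ last`; thus the `i`-th face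
omits `c_i`, and it is the identity on coefficients for `i < n` and `G (c_{n-1} ⟶ c_n)` for
`i = n`. -/
noncomputable def chains (C : Type u) [SmallCategory C] (G : Cᵒᵖ ⥤ AddCommGrpCat.{u}) :
    SimplicialObject AddCommGrpCat.{u} where
  obj m := ∐ coeff G m
  map {m m'} α := Limits.Sigma.desc fun σ =>
    G.map (toLast α σ).op ≫ Limits.Sigma.ι (coeff G m') (restrict α σ)
  map_id m := by
    apply Limits.Sigma.hom_ext
    intro σ
    have h : toLast (𝟙 m) σ = 𝟙 (σ.obj (Fin.last m.unop.len)) := σ.map_id _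
    rw [Limits.Sigma.ι_desc, Category.comp_id, h]
    exact (congrArg (· ≫ Limits.Sigma.ι (coeff G m) σ) (G.map_id _)).trans (Category.id_comp _)
  map_comp {m m' m''} α β := by
    apply Limits.Sigma.hom_ext
    intro σ
    have h : toLast (α ≫ β) σ = toLast β (restrict α σ) ≫ toLast α σ := σ.map_comp _ _
    rw [Limits.Sigma.ι_desc, Limits.Sigma.ι_desc_assoc, Category.assoc, Limits.Sigma.ι_desc]
    exact (congrArg (fun f => G.map (Quiver.Hom.op f) ≫
      Limits.Sigma.ι (coeff G m'') (restrict (α ≫ β) σ)) h).trans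
      ((congrArg (· ≫ Limits.Sigma.ι (coeff G m'') (restrict (α ≫ β) σ))
        (G.map_comp (toLast α σ).op (toLast β (restrict α σ)).op)).trans (Category.assoc _ _ _))

lemma ι_chains_map {C : Type u} [SmallCategory C] (G : Cᵒᵖ ⥤ AddCommGrpCat.{u})
    {m m' : SimplexCategoryᵒᵖ} (α : m ⟶ m') (σ : ComposableArrows C m.unop.len) :
    Limits.Sigma.ι (coeff G m) σ ≫ (chains C G).map α =
      G.map (toLast α σ).op ≫ Limits.Sigma.ι (coeff G m') (restrict α σ) :=
  Limits.Sigma.ι_desc _ _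

/-- The chain complex `C_•(C, G)`, with differential the alternating sum of the faces. -/
noncomputable def chainComplex (C : Type u) [SmallCategory C] (G : Cᵒᵖ ⥤ AddCommGrpCat.{u}) :
    ChainComplex AddCommGrpCat.{u} ℕ :=
  (AlgebraicTopology.alternatingFaceMapComplex AddCommGrpCat.{u}).obj (chains C G)

/-- The homology `H_n(C, G)` of a small category with coefficients in `G : Cᵒᵖ ⥤ Ab`. -/
noncomputable def homology (C : Type u) [SmallCategory C] (G : Cᵒᵖ ⥤ AddCommGrpCat.{u}) (n : ℕ) :
    AddCommGrpCat.{u} :=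
  (chainComplex C G).homology n

/-- The summand of the string `σ` in the group of `m`-chains of `C` with constant coefficients `A`. -/
noncomputable abbrev ιConst (A : AddCommGrpCat.{u}) {C : Type u} [SmallCategory C]
    (m : SimplexCategoryᵒᵖ) (σ : ComposableArrows C m.unop.len) :
    A ⟶ (chains C ((Functor.const _).obj A)).obj m :=
  Limits.Sigma.ι (coeff ((Functor.const Cᵒᵖ).obj A) m) σ

lemma ιConst_map (A : AddCommGrpCat.{u}) {C : Type u} [SmallCategory C]
    {m m' : SimplexCategoryᵒᵖ} (α : m ⟶ m') (σ : ComposableArrows C m.unop.len) :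
    ιConst A m σ ≫ (chains C ((Functor.const _).obj A)).map α = ιConst A m' (restrict α σ) :=
  (ι_chains_map _ α σ).trans (Category.id_comp _)

/-- The map on `m`-chains with constant coefficients `A` that a functor `Φ : C ⥤ C'` induces: the
summand of a string `σ` goes identically to the summand of `Φ σ`. -/
noncomputable def chainsMapApp (A : AddCommGrpCat.{u}) {C C' : Type u} [SmallCategory C]
    [SmallCategory C'] (Φ : C ⥤ C') (m : SimplexCategoryᵒᵖ) :
    (chains C ((Functor.const _).obj A)).obj m ⟶ (chains C' ((Functor.const _).obj A)).obj m :=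
  Limits.Sigma.desc fun σ => ιConst A m (σ ⋙ Φ)

lemma ιConst_chainsMapApp (A : AddCommGrpCat.{u}) {C C' : Type u} [SmallCategory C]
    [SmallCategory C'] (Φ : C ⥤ C') (m : SimplexCategoryᵒᵖ)
    (σ : ComposableArrows C m.unop.len) :
    ιConst A m σ ≫ chainsMapApp A Φ m = ιConst A m (σ ⋙ Φ) :=
  Limits.Sigma.ι_desc _ _

lemma constChains_hom_ext {A : AddCommGrpCat.{u}} {C : Type u} [SmallCategory C]
    {m : SimplexCategoryᵒᵖ} {X : AddCommGrpCat.{u}}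
    {f g : (chains C ((Functor.const _).obj A)).obj m ⟶ X}
    (h : ∀ σ, ιConst A m σ ≫ f = ιConst A m σ ≫ g) : f = g :=
  Limits.Sigma.hom_ext _ _ h

/-- The map of simplicial abelian groups of chains that a functor induces. -/
noncomputable def chainsMap (A : AddCommGrpCat.{u}) {C C' : Type u} [SmallCategory C]
    [SmallCategory C'] (Φ : C ⥤ C') :
    chains C ((Functor.const _).obj A) ⟶ chains C' ((Functor.const _).obj A) where
  app m := chainsMapApp A Φ m
  naturality m m' α := constChains_hom_ext fun σ => by
    rw [← Category.assoc, ← Category.assoc, ιConst_map, ιConst_chainsMapApp, ιConst_chainsMapApp,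
      ιConst_map]
    rfl

lemma chainsMap_id (A : AddCommGrpCat.{u}) (C : Type u) [SmallCategory C] :
    chainsMap A (𝟭 C) = 𝟙 _ :=
  NatTrans.ext (funext fun m => constChains_hom_ext fun σ =>
    (ιConst_chainsMapApp A (𝟭 C) m σ).trans (Category.comp_id _).symm)

lemma chainsMap_comp (A : AddCommGrpCat.{u}) {C C' C'' : Type u} [SmallCategory C]
    [SmallCategory C'] [SmallCategory C''] (Φ : C ⥤ C') (Ψ : C' ⥤ C'') :
    chainsMap A (Φ ⋙ Ψ) = chainsMap A Φ ≫ chainsMap A Ψ :=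
  NatTrans.ext (funext fun m => constChains_hom_ext fun σ => by
    change ιConst A m σ ≫ chainsMapApp A (Φ ⋙ Ψ) m =
      ιConst A m σ ≫ chainsMapApp A Φ m ≫ chainsMapApp A Ψ m
    rw [← Category.assoc, ιConst_chainsMapApp, ιConst_chainsMapApp, ιConst_chainsMapApp]
    rfl)

/-- `C_•(-, A)`, chains with constant coefficients, as a functor on small categories. -/
noncomputable def constChainComplex (A : AddCommGrpCat.{u}) :
    Cat.{u, u} ⥤ ChainComplex AddCommGrpCat.{u} ℕ where
  obj E := chainComplex E ((Functor.const _).obj A)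
  map Φ := (AlgebraicTopology.alternatingFaceMapComplex _).map (chainsMap A Φ.toFunctor)
  map_id E := (congrArg _ (chainsMap_id A E)).trans (CategoryTheory.Functor.map_id _ _)
  map_comp Φ Ψ := (congrArg _ (chainsMap_comp A Φ.toFunctor Ψ.toFunctor)).trans
    (Functor.map_comp _ _ _)

/-- `H_n(-, A)`, homology with constant coefficients, as a functor on small categories. -/
noncomputable def constHomology (A : AddCommGrpCat.{u}) (n : ℕ) :
    Cat.{u, u} ⥤ AddCommGrpCat.{u} :=
  constChainComplex A ⋙ HomologicalComplex.homologyFunctor _ _ n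

end SmallCat

/-! ### Coefficient systems and the double complex of a profunctor -/

namespace Het

variable {C D : Type u} [SmallCategory C] [SmallCategory D]

/-- The coefficient system `c ↦ H_q(P(c, D); A)`, where `P(c, D)` is the category of
heteromorphisms `c ⇝ d` with fixed domain `c`, i.e. the category of elements of `P(c, -)`. -/
noncomputable def coeffC (P : Cᵒᵖ × D ⥤ Type u) (A : AddCommGrpCat.{u}) (q : ℕ) :
    Cᵒᵖ ⥤ AddCommGrpCat.{u} :=
  Functor.curry.obj P ⋙ Functor.elementsFunctor ⋙ SmallCat.constHomology A q

/-- The coefficient system `d ↦ H_p(P(C, d); A)`, where `P(C, d)` is the category of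
heteromorphisms `c ⇝ d` with fixed codomain `d`. A morphism from `φ : c ⇝ d` to `φ' : c' ⇝ d` is
an `f : c ⟶ c'` with `φ' ∘ f = φ`, so `P(C, d)` is the opposite of the category of elements of the
presheaf `P(-, d)`. -/
noncomputable def coeffD (P : Cᵒᵖ × D ⥤ Type u) (A : AddCommGrpCat.{u}) (p : ℕ) :
    D ⥤ AddCommGrpCat.{u} :=
  (Functor.curry.obj P).flip ⋙ Functor.elementsFunctor ⋙ Cat.opFunctor ⋙
    SmallCat.constHomology A p

/-- A chain `c_0 ⟶ ⋯ ⟶ c_p ⇝ d_0 ⟶ ⋯ ⟶ d_q`. -/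
structure Chain (P : Cᵒᵖ × D ⥤ Type u) (p q : SimplexCategoryᵒᵖ) : Type u where
  /-- `c_0 ⟶ ⋯ ⟶ c_p` -/
  left : ComposableArrows C p.unop.len
  /-- `d_0 ⟶ ⋯ ⟶ d_q` -/
  right : ComposableArrows D q.unop.len
  /-- `c_p ⇝ d_0` -/
  het : P.obj (op (left.obj (Fin.last p.unop.len)), right.obj 0)

/-- The action of a pair of simplicial operators on chains, by the operators on both strings and by
composition on the heteromorphism. For cofaces it omits `c_i` or `d_j`, composing the two adjacent
arrows. -/
def Chain.map {P : Cᵒᵖ × D ⥤ Type u} {p p' q q' : SimplexCategoryᵒᵖ} (α : p ⟶ p') (β : q ⟶ q')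
    (x : Chain P p q) : Chain P p' q' where
  left := SmallCat.restrict α x.left
  right := SmallCat.restrict β x.right
  het := P.map ((SmallCat.toLast α x.left).op, SmallCat.fromZero β x.right) x.het

lemma Chain.map_id {P : Cᵒᵖ × D ⥤ Type u} {p q : SimplexCategoryᵒᵖ} (x : Chain P p q) :
    Chain.map (𝟙 p) (𝟙 q) x = x := by
  obtain ⟨σ, τ, φ⟩ := x
  refine congrArg (Chain.mk σ τ) (Eq.trans (congrArg (fun f => P.map f φ) ?_)
    (ConcreteCategory.congr_hom (P.map_id _) φ))
  exact Prod.ext (congrArg Quiver.Hom.op (σ.map_id _)) (τ.map_id _)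

lemma Chain.map_comp {P : Cᵒᵖ × D ⥤ Type u} {p p' p'' q q' q'' : SimplexCategoryᵒᵖ}
    (α : p ⟶ p') (α' : p' ⟶ p'') (β : q ⟶ q') (β' : q' ⟶ q'') (x : Chain P p q) :
    Chain.map (α ≫ α') (β ≫ β') x = Chain.map α' β' (Chain.map α β x) := by
  obtain ⟨σ, τ, φ⟩ := x
  refine congrArg (Chain.mk _ _) (Eq.trans (congrArg (fun f => P.map f φ) ?_)
    (ConcreteCategory.congr_hom (P.map_comp _ _) φ))
  exact Prod.ext (congrArg Quiver.Hom.op (σ.map_comp _ _)) (τ.map_comp _ _)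

/-- The bisimplicial set of chains. -/
def bisimplicialSet (P : Cᵒᵖ × D ⥤ Type u) :
    SimplexCategoryᵒᵖ ⥤ SimplexCategoryᵒᵖ ⥤ Type u where
  obj p :=
    { obj q := Chain P p q
      map β := ↾ Chain.map (𝟙 p) β
      map_id q := by ext x; exact Chain.map_id x
      map_comp β β' := by ext x; exact Chain.map_comp (𝟙 p) (𝟙 p) β β' x }
  map α :=
    { app q := ↾ Chain.map α (𝟙 q)
      naturality q q' β := by
        ext x
        exact (Chain.map_comp (𝟙 _) α β (𝟙 q') x).symm.trans
          (Chain.map_comp α (𝟙 _) (𝟙 q) β x) }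
  map_id p := by ext q x; exact Chain.map_id x
  map_comp α α' := by ext q x; exact Chain.map_comp α α' (𝟙 q) (𝟙 q) x

/-- The double complex `E⁰_{p,q} = ⨁ A`, the sum over all chains
`c_0 ⟶ ⋯ ⟶ c_p ⇝ d_0 ⟶ ⋯ ⟶ d_q`. Both differentials, `E⁰_{p,q} ⟶ E⁰_{p-1,q}` and
`E⁰_{p,q} ⟶ E⁰_{p,q-1}`, are alternating sums of the face maps that omit `c_i`, resp. `d_j`; they
commute. -/
noncomputable def doubleComplex (P : Cᵒᵖ × D ⥤ Type u) (A : AddCommGrpCat.{u}) :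
    HomologicalComplex₂ AddCommGrpCat.{u} (ComplexShape.down ℕ) (ComplexShape.down ℕ) :=
  (AlgebraicTopology.alternatingFaceMapComplex (ChainComplex AddCommGrpCat.{u} ℕ)).obj
    (bisimplicialSet P ⋙
      (Functor.whiskeringRight SimplexCategoryᵒᵖ _ _).obj (Limits.sigmaConst.obj A) ⋙
      AlgebraicTopology.alternatingFaceMapComplex AddCommGrpCat.{u})

end Het

/-! ### Spectral sequences of filtered chain complexes -/

namespace FilteredComplex

/-- `Z^r_p` in degree `n`: the elements of `F_p K_n` whose boundary lies in `F_{p-r} K_{n-1}`, for a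
filtration `F n p = F_p K_n`. (For `n = 0` the map `K.d 0 0` is zero.) -/
def approxCycles (K : ChainComplex AddCommGrpCat.{u} ℕ) (F : ∀ n : ℕ, ℤ → AddSubgroup (K.X n))
    (r p : ℤ) (n : ℕ) : AddSubgroup (K.X n) :=
  F n p ⊓ (F (n - 1) (p - r)).comap (K.d n (n - 1)).hom

/-- `Z^{r-1}_{p-1} + ∂ Z^{r-1}_{p+r-1}` in degree `n`, so that
`E^r_p = Z^r_p / (Z^{r-1}_{p-1} + ∂ Z^{r-1}_{p+r-1})`. -/
def approxBoundaries (K : ChainComplex AddCommGrpCat.{u} ℕ)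
    (F : ∀ n : ℕ, ℤ → AddSubgroup (K.X n)) (r p : ℤ) (n : ℕ) : AddSubgroup (K.X n) :=
  approxCycles K F (r - 1) (p - 1) n ⊔
    (approxCycles K F (r - 1) (p + r - 1) (n + 1)).map (K.d (n + 1) n).hom

/-- An identification of a spectral sequence `E` with positions `(p, q) ∈ ℕ × ℕ` of total degree
`p + q`, starting at page `0`, with the spectral sequence of the filtered complex `(K, F)`; `s (p, q)`
is the filtration degree of the position `(p, q)`. The page `E^r` is the quotient of `Z^r` by
`Z^{r-1}_{p-1} + ∂ Z^{r-1}_{p+r-1}`, its differential is induced by that of `K`, and the given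
isomorphisms `H(E^r) ≅ E^{r+1}` are those that send the class of `x ∈ Z^{r+1} ⊆ Z^r` to the
class of `x`. -/
structure Presentation {c : ℤ → ComplexShape (ℕ × ℕ)}
    (E : SpectralSequence AddCommGrpCat.{u} c 0) (s : ℕ × ℕ → ℕ)
    (K : ChainComplex AddCommGrpCat.{u} ℕ) (F : ∀ n : ℕ, ℤ → AddSubgroup (K.X n)) where
  /-- the quotient map `Z^r ⟶ E^r` -/
  π (r : ℤ) (hr : 0 ≤ r) (pq : ℕ × ℕ) :
    approxCycles K F r (s pq) (pq.1 + pq.2) →+ (E.page r hr).X pq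
  surjective (r : ℤ) (hr : 0 ≤ r) (pq : ℕ × ℕ) : Function.Surjective (π r hr pq)
  π_eq_zero_iff (r : ℤ) (hr : 0 ≤ r) (pq : ℕ × ℕ)
    (x : approxCycles K F r (s pq) (pq.1 + pq.2)) :
    π r hr pq x = 0 ↔ (x : K.X (pq.1 + pq.2)) ∈ approxBoundaries K F r (s pq) (pq.1 + pq.2)
  d_π (r : ℤ) (hr : 0 ≤ r) (pq pq' : ℕ × ℕ) (_ : (c r).Rel pq pq')
    (x : approxCycles K F r (s pq) (pq.1 + pq.2))
    (y : approxCycles K F r (s pq') (pq'.1 + pq'.2))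
    (_ : K.d (pq.1 + pq.2) (pq'.1 + pq'.2) (x : K.X (pq.1 + pq.2)) = y) :
    (E.page r hr).d pq pq' (π r hr pq x) = π r hr pq' y
  iso_π (r : ℤ) (hr : 0 ≤ r) (pq : ℕ × ℕ)
    (x : approxCycles K F r (s pq) (pq.1 + pq.2))
    (x' : approxCycles K F (r + 1) (s pq) (pq.1 + pq.2))
    (_ : (x : K.X (pq.1 + pq.2)) = x')
    (z : (E.page r hr).cycles pq) (_ : (E.page r hr).iCycles pq z = π r hr pq x) :
    (E.iso r (r + 1) pq rfl hr).hom ((E.page r hr).homologyπ pq z) =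
      π (r + 1) (by lia) pq x'

/-- The filtration that `F` induces on homology: `F_p H_n(K)` consists of the classes of the cycles
in `F_p K_n`, i.e. it is the image of `H_n(F_p K)`. -/
noncomputable def homologyFiltration (K : ChainComplex AddCommGrpCat.{u} ℕ)
    (F : ∀ n : ℕ, ℤ → AddSubgroup (K.X n)) (n : ℕ) (p : ℤ) : AddSubgroup (K.homology n) :=
  ((F n p).comap (K.iCycles n).hom).map (K.homologyπ n).hom

/-- A first quadrant spectral sequence `E` converges to the graded group `H` with the filtration
`Φ n p = Φ_p H_n`: the filtration is increasing, with `Φ_{-1} H_n = 0` and `Φ_n H_n = H_n`, and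
`E^∞_{p,q}`, which is `E^r_{p,q}` for every `r ≥ max(p, q) + 2`, is isomorphic to the graded
piece `Φ_s H_{p+q} / Φ_{s-1} H_{p+q}`, where `s = s (p, q)` is the filtration degree of the
position `(p, q)`. -/
def ConvergesTo {c : ℤ → ComplexShape (ℕ × ℕ)}
    (E : SpectralSequence AddCommGrpCat.{u} c 0) (s : ℕ × ℕ → ℕ)
    (H : ℕ → AddCommGrpCat.{u}) (Φ : ∀ n : ℕ, ℤ → AddSubgroup (H n)) : Prop :=
  (∀ n, Monotone (Φ n)) ∧ (∀ n, Φ n (-1) = ⊥) ∧ (∀ n : ℕ, Φ n n = ⊤) ∧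
    ∀ (pq : ℕ × ℕ) (r : ℤ) (hr : 0 ≤ r), (pq.1 : ℤ) + 2 ≤ r → (pq.2 : ℤ) + 2 ≤ r →
      Nonempty ((E.page r hr).X pq ≃+
        Φ (pq.1 + pq.2) (s pq) ⧸
          (Φ (pq.1 + pq.2) ((s pq : ℤ) - 1)).addSubgroupOf (Φ (pq.1 + pq.2) (s pq)))

end FilteredComplex

/-! ### The two filtrations of the total complex of a double complex -/

namespace DoubleComplex

/-- The total complex: `⨁_{i+j=n} K_{i,j}` in degree `n`, with differential
`∂' + (-1)^i ∂''` on `K_{i,j}`. -/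
noncomputable abbrev tot
    (K : HomologicalComplex₂ AddCommGrpCat.{u} (ComplexShape.down ℕ) (ComplexShape.down ℕ)) :
    ChainComplex AddCommGrpCat.{u} ℕ :=
  K.total (ComplexShape.down ℕ)

/-- The filtration by the first index: `F_p Tot_n = ⨁_{i+j=n, i ≤ p} K_{i,j}`. -/
noncomputable def filtration₁
    (K : HomologicalComplex₂ AddCommGrpCat.{u} (ComplexShape.down ℕ) (ComplexShape.down ℕ))
    (n : ℕ) (p : ℤ) : AddSubgroup ((tot K).X n) :=
  ⨆ (i : ℕ) (j : ℕ) (h : i + j = n) (_ : (i : ℤ) ≤ p),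
    (K.ιTotal (ComplexShape.down ℕ) i j n h).hom.range

/-- The filtration by the second index: `F_p Tot_n = ⨁_{i+j=n, j ≤ p} K_{i,j}`. -/
noncomputable def filtration₂
    (K : HomologicalComplex₂ AddCommGrpCat.{u} (ComplexShape.down ℕ) (ComplexShape.down ℕ))
    (n : ℕ) (p : ℤ) : AddSubgroup ((tot K).X n) :=
  ⨆ (i : ℕ) (j : ℕ) (h : i + j = n) (_ : (j : ℤ) ≤ p),
    (K.ιTotal (ComplexShape.down ℕ) i j n h).hom.range

end DoubleComplex

/-! The argument has an algebraic half and a combinatorial half.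

Algebra. A filtered complex has the groups `E^r = Z^r / (Z^{r-1}_{p-1} + ∂ Z^{r-1}_{p+r-1})`.
Everything about them is reduced to one principle, `AddEquiv.ofSurjectives`: two surjections from
one group with the same kernel have isomorphic targets. Applied to maps out of `Z^{r+1}` it gives
`H(E^r) ≅ E^{r+1}` (`pageClass_surjective`, `pageClass_eq_zero_iff`). Applied to `Z^r` for large `r`
it identifies `E^r` with a graded piece of the homology (`toGraded_eq_zero_iff`). Applied to `Z^2`
of a total complex filtered by the first index it identifies `E^2` with the horizontal homology of
the vertical homology (`secondPageClass_surjective`, `secondPageClass_eq_zero_iff`).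

Combinatorics. In a column `p` is fixed, and a chain `c_0 ⟶ ⋯ ⟶ c_p ⇝ d_0 ⟶ ⋯ ⟶ d_q` is the same as
a string `c_0 ⟶ ⋯ ⟶ c_p` together with a string of length `q` in the category `P(c_p, D)`
(`chainFrom_bijective`). Hence a column is the direct sum over the strings in `C` of the complexes
`C_•(P(c_p, D), A)`. Homology commutes with direct sums (`isIso_desc_homologyMap`), so the vertical
homology is the simplicial group of chains of `C` with coefficients `c ↦ H_q(P(c, D))`; omitting
`c_p` induces precisely the coefficient map (`map_columnι`).

The second filtration is the first one for the flipped double complex, whose total complex is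
isomorphic to the original up to the signs `(-1)^{pq}`. In a row the coefficients depend on `d_0`,
the first object of a string in `D`, whereas homology of `Dᵒᵖ` takes them at the last object.
Strings are therefore reversed, which changes the alternating differential only by signs
(`alternatingFaceMapComplexRevIso`). -/

/-! ### Homology of complexes of abelian groups in terms of elements -/

section Surjections

variable {Z A B : Type*} [AddCommGroup Z] [AddCommGroup A] [AddCommGroup B]

/-- Two quotients of the same group by the same subgroup are isomorphic. -/
noncomputable def AddEquiv.ofSurjectives (f : Z →+ A) (g : Z →+ B)
    (hf : Function.Surjective f) (hg : Function.Surjective g) (h : ∀ z, f z = 0 ↔ g z = 0) :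
    A ≃+ B :=
  (QuotientAddGroup.quotientKerEquivOfSurjective f hf).symm.trans
    ((QuotientAddGroup.quotientAddEquivOfEq (AddSubgroup.ext h)).trans
      (QuotientAddGroup.quotientKerEquivOfSurjective g hg))

/-- This formula makes the isomorphisms `H(E^r) ≅ E^{r+1}` computable on representatives, as a
presentation demands. -/
lemma AddEquiv.ofSurjectives_apply (f : Z →+ A) (g : Z →+ B)
    (hf : Function.Surjective f) (hg : Function.Surjective g) (h : ∀ z, f z = 0 ↔ g z = 0)
    (z : Z) : AddEquiv.ofSurjectives f g hf hg h (f z) = g z := by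
  have : (QuotientAddGroup.quotientKerEquivOfSurjective f hf).symm (f z) =
      (z : Z ⧸ f.ker) := by
    rw [AddEquiv.symm_apply_eq]; rfl
  simp only [AddEquiv.ofSurjectives, AddEquiv.trans_apply, this]
  rfl

end Surjections

namespace AbComplex

variable {ι : Type*} {c : ComplexShape ι} (M : HomologicalComplex AddCommGrpCat.{u} c)

lemma d_d_apply (i j k : ι) (x : M.X i) : M.d j k (M.d i j x) = 0 := by
  rw [← ConcreteCategory.comp_apply, M.d_comp_d]; rfl

lemma d_apply_of_not_rel {i j : ι} (h : ¬ c.Rel i j) (x : M.X i) : M.d i j x = 0 := by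
  rw [M.shape _ _ h]; rfl

lemma f_d_apply {M N : HomologicalComplex AddCommGrpCat.{u} c} (f : M ⟶ N) (i j : ι) (x : M.X i) :
    N.d i j (f.f i x) = f.f j (M.d i j x) := by
  rw [← ConcreteCategory.comp_apply, f.comm, ConcreteCategory.comp_apply]

/-- The subgroup of cycles of a complex of abelian groups. -/
def cycleSubgroup (i : ι) : AddSubgroup (M.X i) := ⨅ j, (M.d i j).hom.ker

lemma mem_cycleSubgroup {i : ι} {x : M.X i} :
    x ∈ cycleSubgroup M i ↔ ∀ j, M.d i j x = 0 := by
  simp only [cycleSubgroup, AddSubgroup.mem_iInf, AddMonoidHom.mem_ker]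

/-- The cycle in the homology API that a cycle given as an element defines. -/
noncomputable def toCycles (i : ι) :
    AddCommGrpCat.of (cycleSubgroup M i) ⟶ M.cycles i :=
  M.liftCycles (AddCommGrpCat.ofHom (cycleSubgroup M i).subtype) (c.next i) rfl (by
    ext x
    exact (mem_cycleSubgroup M).1 x.2 _)

lemma iCycles_toCycles (i : ι) (x : cycleSubgroup M i) :
    M.iCycles i (toCycles M i x) = (x : M.X i) := by
  rw [← ConcreteCategory.comp_apply, toCycles, M.liftCycles_i]
  rfl

lemma iCycles_injective (i : ι) : Function.Injective (M.iCycles i) :=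
  (AddCommGrpCat.mono_iff_injective _).1 inferInstance

lemma iCycles_mem (i : ι) (z : M.cycles i) : M.iCycles i z ∈ cycleSubgroup M i := by
  rw [mem_cycleSubgroup]
  intro j
  rw [← ConcreteCategory.comp_apply, M.iCycles_d]
  rfl

/-- The homology class of a cycle. -/
noncomputable def homologyClass (i : ι) : cycleSubgroup M i →+ M.homology i :=
  (toCycles M i ≫ M.homologyπ i).hom

lemma homologyClass_eq (i : ι) (x : cycleSubgroup M i) (z : M.cycles i)
    (h : M.iCycles i z = (x : M.X i)) : homologyClass M i x = M.homologyπ i z := by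
  have : toCycles M i x = z := iCycles_injective M i ((iCycles_toCycles M i x).trans h.symm)
  rw [← this]
  rfl

lemma homologyClass_surjective (i : ι) : Function.Surjective (homologyClass M i) := by
  intro h
  obtain ⟨z, rfl⟩ := (AddCommGrpCat.epi_iff_surjective (M.homologyπ i)).1 inferInstance h
  exact ⟨⟨_, iCycles_mem M i z⟩, homologyClass_eq M i _ z rfl⟩

/-- Homology is the cokernel of the map from chains to cycles. The index `j` may be arbitrary,
because an unrelated `j` has zero differential and only produces `x = 0`. -/
lemma homologyClass_eq_zero_iff (i : ι) (x : cycleSubgroup M i) :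
    homologyClass M i x = 0 ↔ ∃ (j : ι) (y : M.X j), M.d j i y = (x : M.X i) := by
  constructor
  · intro h
    have hex : (ShortComplex.mk (M.toCycles (c.prev i) i) (M.homologyπ i)
        (M.toCycles_comp_homologyπ _ _)).Exact :=
      ShortComplex.exact_of_g_is_cokernel _ (M.homologyIsCokernel (c.prev i) i rfl)
    obtain ⟨y, hy⟩ := (ShortComplex.ab_exact_iff _).1 hex (toCycles M i x) h
    refine ⟨c.prev i, y, ?_⟩
    rw [← iCycles_toCycles, ← M.toCycles_i, ConcreteCategory.comp_apply]
    exact congrArg _ hy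
  · rintro ⟨j, y, hy⟩
    rw [homologyClass_eq M i x (M.toCycles j i y), ← ConcreteCategory.comp_apply,
      M.toCycles_comp_homologyπ]
    · rfl
    · rw [← hy, ← ConcreteCategory.comp_apply, M.toCycles_i]

lemma f_mem_cycleSubgroup {M N : HomologicalComplex AddCommGrpCat.{u} c} (f : M ⟶ N) {i : ι}
    {x : M.X i} (hx : x ∈ cycleSubgroup M i) : f.f i x ∈ cycleSubgroup N i := by
  rw [mem_cycleSubgroup] at hx ⊢
  intro j
  rw [f_d_apply, hx, map_zero]

lemma homologyMap_homologyClass {M N : HomologicalComplex AddCommGrpCat.{u} c} (f : M ⟶ N) (i : ι)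
    (x : cycleSubgroup M i) :
    HomologicalComplex.homologyMap f i (homologyClass M i x) =
      homologyClass N i ⟨f.f i x, f_mem_cycleSubgroup f x.2⟩ := by
  rw [homologyClass_eq N i _ (HomologicalComplex.cyclesMap f i (toCycles M i x)),
    ← ConcreteCategory.comp_apply, ← HomologicalComplex.homologyπ_naturality]
  · rfl
  · rw [← ConcreteCategory.comp_apply, HomologicalComplex.cyclesMap_i,
      ConcreteCategory.comp_apply, iCycles_toCycles]

end AbComplex

/-! ### The spectral sequence of a first quadrant filtered complex -/

namespace FilteredComplex

variable (K : ChainComplex AddCommGrpCat.{u} ℕ) (F : ∀ n : ℕ, ℤ → AddSubgroup (K.X n))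

/-- The filtration `F` of `K` is compatible with the differential and it is concentrated in the first
quadrant. -/
structure IsFirstQuadrant : Prop where
  mono (n : ℕ) : Monotone (F n)
  bot (n : ℕ) : F n (-1) = ⊥
  top (n : ℕ) : F n n = ⊤
  d_mem (n m : ℕ) (p : ℤ) (x : K.X n) : x ∈ F n p → K.d n m x ∈ F m p

/-- The functions `s` and `t` give the filtration degree and the complementary degree of the
positions of a spectral sequence in the first quadrant. -/
structure IsBidegree (c : ℤ → ComplexShape (ℕ × ℕ)) (s t : ℕ × ℕ → ℕ) : Prop where
  add (a : ℕ × ℕ) : s a + t a = a.1 + a.2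
  rel_iff (r : ℤ) (a b : ℕ × ℕ) :
    (c r).Rel a b ↔ (s b : ℤ) = s a - r ∧ (t b : ℤ) = t a + r - 1
  exists_eq (i j : ℕ) : ∃ a, s a = i ∧ t a = j

variable {K F}

lemma IsFirstQuadrant.eq_zero (hF : IsFirstQuadrant K F) {n : ℕ} {p : ℤ} (hp : p < 0) {x : K.X n}
    (hx : x ∈ F n p) : x = 0 := by
  have := hF.mono n (show p ≤ -1 by lia) hx
  rwa [hF.bot, AddSubgroup.mem_bot] at this

lemma IsFirstQuadrant.mem (hF : IsFirstQuadrant K F) {n : ℕ} {p : ℤ} (hp : n ≤ p) (x : K.X n) :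
    x ∈ F n p :=
  hF.mono n hp (by rw [hF.top]; exact AddSubgroup.mem_top x)

/-- Quantifying over every `m` costs nothing, since the differential vanishes unless `m + 1 = n`. It
removes the truncated `n - 1`, in particular at `n = 0`. -/
lemma mem_approxCycles {r p : ℤ} {n : ℕ} {x : K.X n} :
    x ∈ approxCycles K F r p n ↔ x ∈ F n p ∧ ∀ m, K.d n m x ∈ F m (p - r) := by
  constructor
  · rintro ⟨hx, hx'⟩
    refine ⟨hx, fun m => ?_⟩
    by_cases h : m + 1 = n
    · subst h
      exact hx'
    · rw [AbComplex.d_apply_of_not_rel K h]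
      exact zero_mem _
  · rintro ⟨hx, hx'⟩
    exact ⟨hx, hx' _⟩

lemma mem_approxBoundaries {r p : ℤ} {n : ℕ} {x : K.X n} :
    x ∈ approxBoundaries K F r p n ↔
      ∃ y ∈ approxCycles K F (r - 1) (p - 1) n, ∃ (m : ℕ),
        ∃ z ∈ approxCycles K F (r - 1) (p + r - 1) m, y + K.d m n z = x := by
  rw [approxBoundaries, AddSubgroup.mem_sup]
  constructor
  · rintro ⟨y, hy, _, ⟨z, hz, rfl⟩, h⟩
    exact ⟨y, hy, _, z, hz, h⟩
  · rintro ⟨y, hy, m, z, hz, h⟩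
    by_cases hm : n + 1 = m
    · subst hm
      exact ⟨y, hy, _, ⟨z, hz, rfl⟩, h⟩
    · rw [AbComplex.d_apply_of_not_rel K hm] at h
      exact ⟨y, hy, 0, zero_mem _, h⟩

lemma d_mem_approxCycles {r p p' : ℤ} (hp : p' = p - r) {n : ℕ} (m : ℕ) {x : K.X n}
    (hx : x ∈ approxCycles K F r p n) : K.d n m x ∈ approxCycles K F r p' m := by
  rw [mem_approxCycles] at hx ⊢
  subst hp
  refine ⟨hx.2 m, fun k => ?_⟩
  rw [AbComplex.d_d_apply]
  exact zero_mem _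

/-- In `∂(y + ∂z)` only `∂y` survives, and `y ∈ Z^{r-1}_{p-1}` is of the kind allowed in the second
summand at `p - r`, because `(p - r) + r - 1 = p - 1`. -/
lemma d_mem_approxBoundaries {r p p' : ℤ} (hp : p' = p - r) {n : ℕ}
    (m : ℕ) {x : K.X n} (hx : x ∈ approxBoundaries K F r p n) :
    K.d n m x ∈ approxBoundaries K F r p' m := by
  subst hp
  rw [mem_approxBoundaries] at hx ⊢
  obtain ⟨y, hy, k, z, hz, rfl⟩ := hx
  refine ⟨0, zero_mem _, n, y, ?_, ?_⟩
  · rwa [show p - r + r - 1 = p - 1 by ring]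
  · rw [map_add, AbComplex.d_d_apply, zero_add, add_zero]

variable (K F)

/-- The group `E^r_p` in degree `n` of the spectral sequence of a filtered complex. -/
abbrev pageX (r p : ℤ) (n : ℕ) : Type u :=
  approxCycles K F r p n ⧸ (approxBoundaries K F r p n).addSubgroupOf (approxCycles K F r p n)

/-- The map `Z^r_p ⟶ Z^r_{p-r}` that the differential induces. -/
def dApproxCycles {r p p' : ℤ} (hp : p' = p - r) (n m : ℕ) :
    approxCycles K F r p n →+ approxCycles K F r p' m :=
  ((K.d n m).hom.comp (AddSubgroup.subtype _)).codRestrict _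
    fun x => d_mem_approxCycles hp m x.2

variable {K F}

/-- The differential `E^r_p ⟶ E^r_{p-r}`. -/
def pageD {r p p' : ℤ} (hp : p' = p - r) (n m : ℕ) :
    pageX K F r p n →+ pageX K F r p' m :=
  QuotientAddGroup.map _ _ (dApproxCycles K F hp n m)
    fun _ hx => d_mem_approxBoundaries hp m hx

lemma pageD_mk {r p p' : ℤ} (hp : p' = p - r) (n m : ℕ)
    (x : approxCycles K F r p n) (y : approxCycles K F r p' m)
    (h : K.d n m (x : K.X n) = y) :
    pageD hp n m (QuotientAddGroup.mk x) = QuotientAddGroup.mk y :=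
  congrArg QuotientAddGroup.mk (Subtype.ext h : dApproxCycles K F hp n m x = y)

lemma mk_eq_zero_iff {r p : ℤ} {n : ℕ} (x : approxCycles K F r p n) :
    (QuotientAddGroup.mk x : pageX K F r p n) = 0 ↔
      (x : K.X n) ∈ approxBoundaries K F r p n := by
  rw [QuotientAddGroup.eq_zero_iff, AddSubgroup.mem_addSubgroupOf]

lemma mk_eq_mk_iff {r p : ℤ} {n : ℕ} (x y : approxCycles K F r p n) :
    (QuotientAddGroup.mk x : pageX K F r p n) = QuotientAddGroup.mk y ↔
      (x : K.X n) - y ∈ approxBoundaries K F r p n := by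
  rw [← sub_eq_zero, ← QuotientAddGroup.mk_sub, mk_eq_zero_iff]
  rfl

/-! ### Pages as complexes on the positions of the quadrant. -/

variable {c : ℤ → ComplexShape (ℕ × ℕ)} {s t : ℕ × ℕ → ℕ}

variable (K F) in
open Classical in
/-- The page `E^r`. -/
noncomputable def page (hc : IsBidegree c s t) (r : ℤ) :
    HomologicalComplex AddCommGrpCat.{u} (c r) where
  X a := AddCommGrpCat.of (pageX K F r (s a) (a.1 + a.2))
  d a b := if h : (c r).Rel a b then
    AddCommGrpCat.ofHom (pageD ((hc.rel_iff r a b).1 h).1 (a.1 + a.2) (b.1 + b.2)) else 0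
  shape a b h := dif_neg h
  d_comp_d' a b b' h h' := by
    rw [dif_pos h, dif_pos h']
    ext x
    refine congrArg QuotientAddGroup.mk (?_ : _ = (0 : approxCycles K F r _ _))
    exact Subtype.ext (AbComplex.d_d_apply K _ _ _ x.1)

variable (K F) in
/-- The class in `E^r` of an element of `Z^r`. -/
noncomputable def pageπ (hc : IsBidegree c s t) (r : ℤ) (a : ℕ × ℕ) :
    approxCycles K F r (s a) (a.1 + a.2) →+ (page K F hc r).X a :=
  QuotientAddGroup.mk' _

section

variable (hc : IsBidegree c s t) (r : ℤ) (a b : ℕ × ℕ)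

lemma pageπ_surjective : Function.Surjective (pageπ K F hc r a) :=
  QuotientAddGroup.mk_surjective

lemma pageπ_eq_zero_iff (x : approxCycles K F r (s a) (a.1 + a.2)) :
    pageπ K F hc r a x = 0 ↔ (x : K.X (a.1 + a.2)) ∈ approxBoundaries K F r (s a) (a.1 + a.2) :=
  mk_eq_zero_iff x

lemma pageπ_eq_iff (x y : approxCycles K F r (s a) (a.1 + a.2)) :
    pageπ K F hc r a x = pageπ K F hc r a y ↔
      (x : K.X (a.1 + a.2)) - y ∈ approxBoundaries K F r (s a) (a.1 + a.2) :=
  mk_eq_mk_iff x y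

lemma page_d_pageπ (h : (c r).Rel a b) (x : approxCycles K F r (s a) (a.1 + a.2))
    (y : approxCycles K F r (s b) (b.1 + b.2))
    (hxy : K.d (a.1 + a.2) (b.1 + b.2) (x : K.X (a.1 + a.2)) = y) :
    (page K F hc r).d a b (pageπ K F hc r a x) = pageπ K F hc r b y := by
  simp only [page, dif_pos h]
  exact pageD_mk _ _ _ x y hxy

lemma page_d_pageπ_eq_zero_iff (h : (c r).Rel a b) (x : approxCycles K F r (s a) (a.1 + a.2)) :
    (page K F hc r).d a b (pageπ K F hc r a x) = 0 ↔
      K.d (a.1 + a.2) (b.1 + b.2) (x : K.X (a.1 + a.2)) ∈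
        approxBoundaries K F r (s b) (b.1 + b.2) := by
  rw [page_d_pageπ hc r a b h x ⟨_, d_mem_approxCycles ((hc.rel_iff r a b).1 h).1 _ x.2⟩ rfl,
    pageπ_eq_zero_iff]

/-- The target of `d^r` lies outside the quadrant only if `s a - r` or `t a + r - 1` is negative. As
`r ≥ 0`, the latter forces `r = 0` and `t a = 0`. -/
lemma IsBidegree.exists_rel_left (hc : IsBidegree c s t) {r : ℤ} (hr : 0 ≤ r) {a : ℕ × ℕ} {n : ℕ}
    (h : n + 1 = a.1 + a.2) :
    (∃ b, (c r).Rel a b ∧ b.1 + b.2 = n) ∨ (s a : ℤ) - r < 0 ∨ (r = 0 ∧ t a = 0) := by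
  by_cases hs : (s a : ℤ) - r < 0
  · exact .inr (.inl hs)
  by_cases ht : r = 0 ∧ t a = 0
  · exact .inr (.inr ht)
  refine .inl ?_
  have h₁ := hc.add a
  obtain ⟨b, hb, hb'⟩ := hc.exists_eq ((s a : ℤ) - r).toNat ((t a : ℤ) + r - 1).toNat
  have h₂ := hc.add b
  refine ⟨b, (hc.rel_iff _ _ _).2 ⟨?_, ?_⟩, ?_⟩ <;> omega

/-- The source of `d^r` lies outside the quadrant only if `t a - r + 1 < 0`. The resulting bound
says that `F_{s+r-1}` is already all of `K_n`. -/
lemma IsBidegree.exists_rel_right (hc : IsBidegree c s t) {r : ℤ} (hr : 0 ≤ r) {a : ℕ × ℕ} {n : ℕ}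
    (h : n = a.1 + a.2 + 1) :
    (∃ b, (c r).Rel b a ∧ b.1 + b.2 = n) ∨ (n : ℤ) ≤ s a + r - 1 := by
  by_cases hs : (n : ℤ) ≤ s a + r - 1
  · exact .inr hs
  refine .inl ?_
  have h₁ := hc.add a
  obtain ⟨b, hb, hb'⟩ := hc.exists_eq ((s a : ℤ) + r).toNat ((t a : ℤ) - r + 1).toNat
  have h₂ := hc.add b
  refine ⟨b, (hc.rel_iff _ _ _).2 ⟨?_, ?_⟩, ?_⟩ <;> omega

/-! ### The homology of `E^r` is `E^{r+1}`. -/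

lemma approxCycles_succ_le (hF : IsFirstQuadrant K F) (r p : ℤ) (n : ℕ) :
    approxCycles K F (r + 1) p n ≤ approxCycles K F r p n := by
  intro x hx
  rw [mem_approxCycles] at hx ⊢
  exact ⟨hx.1, fun m => hF.mono m (by lia) (hx.2 m)⟩

/-- Classes of elements of `Z^{r+1}` in the homology of the page `E^r`. -/
lemma pageπ_mem_cycleSubgroup (hF : IsFirstQuadrant K F)
    (x : approxCycles K F (r + 1) (s a) (a.1 + a.2)) :
    pageπ K F hc r a ⟨x, approxCycles_succ_le hF _ _ _ x.2⟩ ∈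
      AbComplex.cycleSubgroup (page K F hc r) a := by
  rw [AbComplex.mem_cycleSubgroup]
  intro b
  by_cases h : (c r).Rel a b
  · rw [page_d_pageπ_eq_zero_iff hc r a b h, mem_approxBoundaries]
    -- The boundary of `x` drops by `r + 1`, so it lies in `Z^{r-1}_{s b - 1}`, the first summand of
    -- the denominator of `E^r` at `b`.
    refine ⟨_, ?_, 0, 0, zero_mem _, by rw [map_zero, add_zero]⟩
    have := (hc.rel_iff r a b).1 h
    refine mem_approxCycles.2 ⟨?_, fun m => ?_⟩
    · have := (mem_approxCycles.1 x.2).2 (b.1 + b.2)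
      rwa [show (s b : ℤ) - 1 = s a - (r + 1) by lia]
    · rw [AbComplex.d_d_apply]
      exact zero_mem _
  · exact AbComplex.d_apply_of_not_rel _ h _

/-- The map `Z^{r+1} ⟶ H(E^r)`. -/
noncomputable def pageClass (hF : IsFirstQuadrant K F) :
    approxCycles K F (r + 1) (s a) (a.1 + a.2) →+ (page K F hc r).homology a :=
  (AbComplex.homologyClass (page K F hc r) a).comp
    (((pageπ K F hc r a).comp (AddSubgroup.inclusion (approxCycles_succ_le hF _ _ _))).codRestrict
      _ (pageπ_mem_cycleSubgroup hc r a hF))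

lemma pageClass_apply (hF : IsFirstQuadrant K F)
    (x : approxCycles K F (r + 1) (s a) (a.1 + a.2)) :
    pageClass hc r a hF x =
      AbComplex.homologyClass (page K F hc r) a ⟨_, pageπ_mem_cycleSubgroup hc r a hF x⟩ := rfl

/-- If `d^r` kills the class of `x`, then `∂x = y + ∂z` with `y` one step deeper than `F_{s a - r}`
and `z ∈ Z^{r-1}_{s a - 1}`. Then `z` is zero in `E^r`, and `x - z` has boundary `y`, so it lies in
`Z^{r+1}`. -/
lemma exists_sub_mem_approxCycles_succ (hF : IsFirstQuadrant K F) (hr : 0 ≤ r)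
    (x : approxCycles K F r (s a) (a.1 + a.2))
    (hx : ∀ b, (page K F hc r).d a b (pageπ K F hc r a x) = 0) :
    ∃ w ∈ approxBoundaries K F r (s a) (a.1 + a.2),
      (x : K.X (a.1 + a.2)) - w ∈ approxCycles K F (r + 1) (s a) (a.1 + a.2) := by
  have hx' := mem_approxCycles.1 x.2
  by_cases hn : ∃ b, (c r).Rel a b ∧ b.1 + b.2 + 1 = a.1 + a.2
  · obtain ⟨b, hb, hab⟩ := hn
    have hb' := (hc.rel_iff r a b).1 hb
    have := (page_d_pageπ_eq_zero_iff hc r a b hb x).1 (hx b)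
    obtain ⟨y, hy, m, z, hz, h⟩ := mem_approxBoundaries.1 this
    rw [show (s b : ℤ) + r - 1 = s a - 1 by lia] at hz
    by_cases hm : b.1 + b.2 + 1 = m
    · obtain rfl : m = a.1 + a.2 := by lia
      refine ⟨z, mem_approxBoundaries.2 ⟨z, hz, 0, 0, zero_mem _, by rw [map_zero, add_zero]⟩, ?_⟩
      refine mem_approxCycles.2 ⟨sub_mem hx'.1 (hF.mono _ (by lia) (mem_approxCycles.1 hz).1), ?_⟩
      intro k
      by_cases hk : b.1 + b.2 = k
      · subst hk
        rw [map_sub, ← h, add_sub_cancel_right]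
        have := (mem_approxCycles.1 hy).1
        rwa [show (s a : ℤ) - (r + 1) = s b - 1 by lia]
      · rw [AbComplex.d_apply_of_not_rel K (by simp; lia)]
        exact zero_mem _
    · rw [AbComplex.d_apply_of_not_rel K hm, add_zero] at h
      refine ⟨0, zero_mem _, ?_⟩
      rw [sub_zero]
      refine mem_approxCycles.2 ⟨hx'.1, fun k => ?_⟩
      by_cases hk : b.1 + b.2 = k
      · subst hk
        rw [← h]
        have := (mem_approxCycles.1 hy).1
        rwa [show (s a : ℤ) - (r + 1) = s b - 1 by lia]
      · rw [AbComplex.d_apply_of_not_rel K (by simp; lia)]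
        exact zero_mem _
  -- Without a target position `x` itself is in `Z^{r+1}`: either `∂x` has negative filtration
  -- degree and vanishes, or `r = 0` and `t a = 0`, and then `F_{s a - 1}` is everything in degree
  -- `s a - 1`.
  · refine ⟨0, zero_mem _, ?_⟩
    rw [sub_zero]
    refine mem_approxCycles.2 ⟨hx'.1, fun k => ?_⟩
    by_cases hk : k + 1 = a.1 + a.2
    · obtain ⟨b, hb, h⟩ | h | h := hc.exists_rel_left hr hk
      · exact (hn ⟨b, hb, by lia⟩).elim
      · rw [hF.eq_zero h (hx'.2 k)]
        exact zero_mem _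
      · have := hc.add a
        exact hF.mem (by lia) _
    · rw [AbComplex.d_apply_of_not_rel K hk]
      exact zero_mem _

lemma pageClass_surjective (hF : IsFirstQuadrant K F) (hr : 0 ≤ r) :
    Function.Surjective (pageClass hc r a hF) := by
  intro y
  obtain ⟨⟨y, hy⟩, rfl⟩ := AbComplex.homologyClass_surjective _ _ y
  obtain ⟨x, rfl⟩ := pageπ_surjective hc r a y
  obtain ⟨w, hw, hxw⟩ := exists_sub_mem_approxCycles_succ hc r a hF hr x
    ((AbComplex.mem_cycleSubgroup _).1 hy)
  refine ⟨⟨_, hxw⟩, ?_⟩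
  rw [pageClass_apply]
  refine congrArg _ (Subtype.ext ?_)
  refine (pageπ_eq_iff hc r a _ _).2 ?_
  simpa using neg_mem hw

/-- With `p = s a`, a class that is a `d^r`-boundary has `x = v + ∂(y + w)` with `v ∈
Z^{r-1}_{p-1}`, `y ∈ Z^r_{p+r}` and `w ∈ Z^{r-1}_{p+r-1}`. Since `∂v = ∂x` and `x ∈ Z^{r+1}_p`, the
element `v` is even in `Z^r_{p-1}`; also `y + w ∈ Z^r_{p+r}`. These are the two summands of the
denominator of `E^{r+1}`. -/
lemma pageClass_eq_zero_iff (hF : IsFirstQuadrant K F) (hr : 0 ≤ r)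
    (x : approxCycles K F (r + 1) (s a) (a.1 + a.2)) :
    pageClass hc r a hF x = 0 ↔
      (x : K.X (a.1 + a.2)) ∈ approxBoundaries K F (r + 1) (s a) (a.1 + a.2) := by
  rw [pageClass_apply, AbComplex.homologyClass_eq_zero_iff]
  have hx := mem_approxCycles.1 x.2
  have key : ∀ y : approxCycles K F r (s a + r) (a.1 + a.2 + 1),
      (x : K.X (a.1 + a.2)) - K.d _ _ (y : K.X (a.1 + a.2 + 1)) ∈
        approxBoundaries K F r (s a) (a.1 + a.2) →
      (x : K.X (a.1 + a.2)) ∈ approxBoundaries K F (r + 1) (s a) (a.1 + a.2) := by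
    intro y hy
    obtain ⟨v, hv, m, w, hw, h⟩ := mem_approxBoundaries.1 hy
    have hv' := (mem_approxCycles.1 hv).1
    have hy' := mem_approxCycles.1 y.2
    by_cases hm : a.1 + a.2 + 1 = m
    · subst hm
      have hw' := mem_approxCycles.1 hw
      have hv₂ : v = (x : K.X (a.1 + a.2)) - K.d (a.1 + a.2 + 1) _ ((y : K.X _) + w) := by
        rw [map_add, ← sub_sub, ← h, add_sub_cancel_right]
      refine mem_approxBoundaries.2 ⟨v, mem_approxCycles.2 ⟨hv', fun k => ?_⟩, _, (y : K.X _) + w,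
        mem_approxCycles.2 ⟨add_mem ?_ ?_, fun k => ?_⟩, ?_⟩
      · rw [hv₂, map_sub, AbComplex.d_d_apply, sub_zero]
        exact hF.mono _ (by lia) (hx.2 k)
      · exact hF.mono _ (by lia) hy'.1
      · exact hF.mono _ (by lia) hw'.1
      · rw [map_add]
        exact add_mem (hF.mono _ (by lia) (hy'.2 k)) (hF.mono _ (by lia) (hw'.2 k))
      · rw [hv₂, sub_add_cancel]
    · rw [AbComplex.d_apply_of_not_rel K hm, add_zero] at h
      refine mem_approxBoundaries.2 ⟨v, mem_approxCycles.2 ⟨hv', fun k => ?_⟩,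
        a.1 + a.2 + 1, y,
        ?_, ?_⟩
      · rw [h, map_sub, AbComplex.d_d_apply, sub_zero]
        exact hF.mono _ (by lia) (hx.2 k)
      · convert y.2 using 1
        lia
      · rw [h, sub_add_cancel]
  constructor
  · rintro ⟨b, y, hy⟩
    by_cases hb : (c r).Rel b a
    · have hb' := (hc.rel_iff r b a).1 hb
      obtain ⟨y, rfl⟩ := pageπ_surjective hc r b y
      rw [page_d_pageπ hc r b a hb _ ⟨_, d_mem_approxCycles hb'.1 _ y.2⟩ rfl, eq_comm,
        pageπ_eq_iff] at hy
      obtain ⟨y, hy'⟩ := y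
      have hab : b.1 + b.2 = a.1 + a.2 + 1 := by
        have h₁ := hc.add a
        have h₂ := hc.add b
        lia
      have hs : (s b : ℤ) = s a + r := by lia
      generalize b.1 + b.2 = n at *
      subst hab
      rw [hs] at hy'
      exact key ⟨y, hy'⟩ hy
    -- An unrelated `b` contributes no boundary, so the class of `x` is already zero in `E^r`.
    · rw [AbComplex.d_apply_of_not_rel _ hb, eq_comm, pageπ_eq_zero_iff] at hy
      exact key 0 (by simpa using hy)
  · intro h
    obtain ⟨v, hv, m, w, hw, h⟩ := mem_approxBoundaries.1 h
    rw [show r + 1 - 1 = r by lia] at hv hw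
    rw [show (s a : ℤ) + (r + 1) - 1 = s a + r by lia] at hw
    have hv' := mem_approxCycles.1 hv
    have hv₂ : v ∈ approxBoundaries K F r (s a) (a.1 + a.2) :=
      mem_approxBoundaries.2 ⟨v, mem_approxCycles.2 ⟨hv'.1, fun k =>
        hF.mono _ (by lia) (hv'.2 k)⟩, 0, 0, zero_mem _, by rw [map_zero, add_zero]⟩
    by_cases hm : m = a.1 + a.2 + 1
    · obtain ⟨b, hb, hbm⟩ | hs := hc.exists_rel_right hr hm
      · subst hbm
        have hb' := (hc.rel_iff r b a).1 hb
        rw [show (s a : ℤ) + r = s b by lia] at hw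
        refine ⟨b, pageπ K F hc r b ⟨w, hw⟩, ?_⟩
        rw [page_d_pageπ hc r b a hb _ ⟨_, d_mem_approxCycles hb'.1 _ hw⟩ rfl, eq_comm,
          pageπ_eq_iff]
        simpa [← h] using hv₂
      -- No position is the source. Then `F_{s a + r - 1}` is the whole group in degree `m`, so `w ∈
      -- Z^{r-1}_{s a + r - 1}` and `∂w` already vanishes in `E^r`.
      · refine ⟨a, 0, ?_⟩
        rw [map_zero, eq_comm, pageπ_eq_zero_iff, ← h]
        refine add_mem hv₂ (mem_approxBoundaries.2 ⟨0, zero_mem _, m, w,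
          mem_approxCycles.2 ⟨hF.mem hs _, fun k => ?_⟩, zero_add _⟩)
        exact hF.mono _ (by lia) ((mem_approxCycles.1 hw).2 k)
    · refine ⟨a, 0, ?_⟩
      rw [AbComplex.d_apply_of_not_rel K (by simp; lia), add_zero] at h
      rw [map_zero, eq_comm, pageπ_eq_zero_iff, ← h]
      exact hv₂

/-- The isomorphism `H(E^r) ≅ E^{r+1}`. -/
noncomputable def pageIso (hF : IsFirstQuadrant K F) (hr : 0 ≤ r) (r' : ℤ) (hr' : r + 1 = r') :
    (page K F hc r).homology a ≅ (page K F hc r').X a :=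
  AddEquiv.toAddCommGrpIso (by
    subst hr'
    exact AddEquiv.ofSurjectives (pageClass hc r a hF) (pageπ K F hc (r + 1) a)
      (pageClass_surjective hc r a hF hr) (pageπ_surjective hc (r + 1) a)
      (fun z => (pageClass_eq_zero_iff hc r a hF hr z).trans
        (pageπ_eq_zero_iff hc (r + 1) a z).symm))

lemma pageIso_pageClass (hF : IsFirstQuadrant K F) (hr : 0 ≤ r)
    (x : approxCycles K F (r + 1) (s a) (a.1 + a.2)) :
    (pageIso hc r a hF hr _ rfl).hom (pageClass hc r a hF x) = pageπ K F hc (r + 1) a x :=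
  AddEquiv.ofSurjectives_apply (pageClass hc r a hF) (pageπ K F hc (r + 1) a)
      (pageClass_surjective hc r a hF hr) (pageπ_surjective hc (r + 1) a) _ x

end

/-- The spectral sequence of a first quadrant filtered complex. -/
noncomputable def spectralSequence (hF : IsFirstQuadrant K F) (hc : IsBidegree c s t) :
    SpectralSequence AddCommGrpCat.{u} c 0 where
  page r _ := page K F hc r
  iso r r' a h hr := pageIso hc r a hF hr r' h

/-- The spectral sequence of a filtered complex has the expected presentation. -/
noncomputable def presentation (hF : IsFirstQuadrant K F) (hc : IsBidegree c s t) :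
    Presentation (spectralSequence hF hc) s K F where
  π r _ a := pageπ K F hc r a
  surjective r _ a := pageπ_surjective hc r a
  π_eq_zero_iff r _ a x := pageπ_eq_zero_iff hc r a x
  d_π r _ a b h x y hxy := page_d_pageπ hc r a b h x y hxy
  iso_π r hr a x x' hxx' z hz := by
    refine Eq.trans (congrArg _ ?_) (pageIso_pageClass hc r a hF hr x')
    rw [pageClass_apply]
    refine (AbComplex.homologyClass_eq _ a _ z (hz.trans ?_)).symm
    exact congrArg _ (Subtype.ext hxx')

end FilteredComplex

/-! ### Convergence -/

namespace FilteredComplex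

variable {K : ChainComplex AddCommGrpCat.{u} ℕ} {F : ∀ n : ℕ, ℤ → AddSubgroup (K.X n)}

lemma mem_homologyFiltration {n : ℕ} {p : ℤ} {h : K.homology n} :
    h ∈ homologyFiltration K F n p ↔
      ∃ x : AbComplex.cycleSubgroup K n, (x : K.X n) ∈ F n p ∧
        AbComplex.homologyClass K n x = h := by
  constructor
  · rintro ⟨z, hz, rfl⟩
    exact ⟨⟨_, AbComplex.iCycles_mem K n z⟩, hz, AbComplex.homologyClass_eq K n _ z rfl⟩
  · rintro ⟨x, hx, rfl⟩
    refine ⟨AbComplex.toCycles K n x, ?_, rfl⟩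
    change K.iCycles n (AbComplex.toCycles K n x) ∈ F n p
    rwa [AbComplex.iCycles_toCycles]

lemma mem_cycleSubgroup_of_mem_approxCycles (hF : IsFirstQuadrant K F) {r p : ℤ} (hr : p < r)
    {n : ℕ} {x : K.X n} (hx : x ∈ approxCycles K F r p n) : x ∈ AbComplex.cycleSubgroup K n := by
  rw [AbComplex.mem_cycleSubgroup]
  exact fun m => hF.eq_zero (by lia) ((mem_approxCycles.1 hx).2 m)

/-- The map from `Z^r_p`, for large `r`, to the graded piece of the homology. -/
noncomputable def toGraded (hF : IsFirstQuadrant K F) (r p : ℤ) (hr : p < r) (n : ℕ) :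
    approxCycles K F r p n →+ homologyFiltration K F n p ⧸
      (homologyFiltration K F n (p - 1)).addSubgroupOf (homologyFiltration K F n p) :=
  (QuotientAddGroup.mk' _).comp
    (((AbComplex.homologyClass K n).comp
      (AddSubgroup.inclusion fun _ h => mem_cycleSubgroup_of_mem_approxCycles hF hr h)).codRestrict
        (homologyFiltration K F n p)
        fun x => mem_homologyFiltration.2 ⟨_, (mem_approxCycles.1 x.2).1, rfl⟩)

lemma toGraded_surjective (hF : IsFirstQuadrant K F) (r p : ℤ) (hr : p < r) (n : ℕ) :
    Function.Surjective (toGraded hF r p hr n) := by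
  intro y
  obtain ⟨⟨y, hy⟩, rfl⟩ := QuotientAddGroup.mk_surjective y
  obtain ⟨x, hx, rfl⟩ := mem_homologyFiltration.1 hy
  have hx' := (AbComplex.mem_cycleSubgroup K).1 x.2
  exact ⟨⟨x, mem_approxCycles.2 ⟨hx, fun m => by rw [hx']; exact zero_mem _⟩⟩, rfl⟩

/-- The bound `hn` makes `F_{p+r-1}` exhaust degree `n + 1`. Every chain whose boundary is `x - y`,
with `x ∈ F_p` and `y ∈ F_{p-1}`, is then in `Z^{r-1}_{p+r-1}`, so being homologous to a cycle in
`F_{p-1}` is the same as lying in the denominator of `E^r_p`. -/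
lemma toGraded_eq_zero_iff (hF : IsFirstQuadrant K F) (r p : ℤ) (hr : p < r) (n : ℕ)
    (hn : n + 2 ≤ p + r) (x : approxCycles K F r p n) :
    toGraded hF r p hr n x = 0 ↔ (x : K.X n) ∈ approxBoundaries K F r p n := by
  have hx := (AbComplex.mem_cycleSubgroup K).1 (mem_cycleSubgroup_of_mem_approxCycles hF hr x.2)
  refine Iff.trans (QuotientAddGroup.eq_zero_iff _) (Iff.trans AddSubgroup.mem_addSubgroupOf ?_)
  refine Iff.trans mem_homologyFiltration ?_
  constructor
  · rintro ⟨y, hy, hxy⟩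
    replace hxy : _ = AbComplex.homologyClass K n
      ⟨x, mem_cycleSubgroup_of_mem_approxCycles hF hr x.2⟩ := hxy
    rw [eq_comm, ← sub_eq_zero, ← map_sub, AbComplex.homologyClass_eq_zero_iff] at hxy
    obtain ⟨m, w, hw⟩ := hxy
    replace hw : K.d m n w = (x : K.X n) - y := hw
    have hy' := (AbComplex.mem_cycleSubgroup K).1 y.2
    have hyc : (y : K.X n) ∈ approxCycles K F (r - 1) (p - 1) n :=
      mem_approxCycles.2 ⟨hy, fun k => by rw [hy']; exact zero_mem _⟩
    by_cases hm : n + 1 = m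
    · refine mem_approxBoundaries.2 ⟨y, hyc, m, w, mem_approxCycles.2 ⟨hF.mem (by lia) _,
        fun k => ?_⟩, by rw [hw, add_sub_cancel]⟩
      by_cases hk : k = n
      · subst hk
        rw [hw]
        exact sub_mem (hF.mono _ (by lia) (mem_approxCycles.1 x.2).1) (hF.mono _ (by lia) hy)
      · rw [AbComplex.d_apply_of_not_rel K (by simp; lia)]
        exact zero_mem _
    · rw [AbComplex.d_apply_of_not_rel K hm, eq_comm, sub_eq_zero] at hw
      rw [hw]
      exact mem_approxBoundaries.2 ⟨y, hyc, 0, 0, zero_mem _, by rw [map_zero, add_zero]⟩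
  · intro h
    obtain ⟨y, hy, m, z, hz, h⟩ := mem_approxBoundaries.1 h
    have hy' := mem_approxCycles.1 hy
    -- Since `x` is a cycle and `x - y` is a boundary, `y` is a cycle as well.
    refine ⟨⟨y, (AbComplex.mem_cycleSubgroup K).2 fun k => ?_⟩, hy'.1, ?_⟩
    · have := congrArg (K.d n k) h
      rwa [map_add, AbComplex.d_d_apply, hx, add_zero] at this
    · change _ = AbComplex.homologyClass K n
        ⟨x, mem_cycleSubgroup_of_mem_approxCycles hF hr x.2⟩
      rw [eq_comm, ← sub_eq_zero, ← map_sub, AbComplex.homologyClass_eq_zero_iff]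
      exact ⟨m, z, (eq_sub_of_add_eq' h)⟩

variable {c : ℤ → ComplexShape (ℕ × ℕ)} {s t : ℕ × ℕ → ℕ}

lemma spectralSequence_convergesTo (hF : IsFirstQuadrant K F) (hc : IsBidegree c s t)
    (hst : ∀ a, s a ≤ max a.1 a.2 ∧ t a ≤ max a.1 a.2) :
    ConvergesTo (spectralSequence hF hc) s (fun n => K.homology n) (homologyFiltration K F) := by
  refine ⟨fun n p p' hp h hh => ?_, fun n => ?_, fun n => ?_, fun a r hr h₁ h₂ => ?_⟩
  · obtain ⟨x, hx, rfl⟩ := mem_homologyFiltration.1 hh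
    exact mem_homologyFiltration.2 ⟨x, hF.mono n hp hx, rfl⟩
  · rw [eq_bot_iff]
    intro h hh
    obtain ⟨x, hx, rfl⟩ := mem_homologyFiltration.1 hh
    rw [hF.bot, AddSubgroup.mem_bot] at hx
    obtain rfl : x = 0 := Subtype.ext hx
    rw [map_zero]
    exact zero_mem _
  · rw [eq_top_iff]
    rintro h -
    obtain ⟨x, rfl⟩ := AbComplex.homologyClass_surjective K n h
    exact mem_homologyFiltration.2 ⟨x, hF.mem le_rfl _, rfl⟩
  -- The bound `max + 2 ≤ r` on the page gives `s < r`, so that `Z^r` consists of cycles, and `t + 2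
  -- ≤ r`, so that all relevant boundaries are counted.
  · have ha := hc.add a
    have hs : (s a : ℤ) < r := by have := hst a; lia
    have hn : (a.1 + a.2 : ℕ) + 2 ≤ (s a : ℤ) + r := by have := hst a; lia
    exact ⟨AddEquiv.ofSurjectives (pageπ K F hc r a) (toGraded hF r (s a) hs (a.1 + a.2))
      (pageπ_surjective hc r a) (toGraded_surjective hF r (s a) hs _)
      fun z => (pageπ_eq_zero_iff hc r a z).trans
        (toGraded_eq_zero_iff hF r (s a) hs (a.1 + a.2) hn z).symm⟩

end FilteredComplex

/-! ### The total complex of a double complex in terms of elements -/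

namespace DoubleComplex

open HomologicalComplex₂

variable (K : HomologicalComplex₂ AddCommGrpCat.{u} (ComplexShape.down ℕ) (ComplexShape.down ℕ))

/-- The inclusion of a summand of the total complex. -/
noncomputable abbrev ι (i j n : ℕ) (h : i + j = n) : (K.X i).X j ⟶ (tot K).X n :=
  K.ιTotal (ComplexShape.down ℕ) i j n h

/-- The projection to a summand of the total complex. -/
noncomputable def pr (i j n : ℕ) (h : i + j = n) : (tot K).X n ⟶ (K.X i).X j :=
  K.totalDesc fun i' j' h' =>
    if hi : i' = i then (K.XXIsoOfEq _ _ _ hi (by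
      have : i' + j' = n := h'
      lia)).hom else 0

lemma ι_pr_self (i j n : ℕ) (h : i + j = n) : ι K i j n h ≫ pr K i j n h = 𝟙 _ := by
  simp [pr]

lemma ι_pr_of_ne {i i' : ℕ} (hi : i' ≠ i) (j j' n : ℕ) (h' : i' + j' = n) (h : i + j = n) :
    ι K i' j' n h' ≫ pr K i j n h = 0 := by
  simp [pr, hi]

lemma pr_ι_self_apply (i j n : ℕ) (h : i + j = n) (x : (K.X i).X j) :
    pr K i j n h (ι K i j n h x) = x := by
  rw [← ConcreteCategory.comp_apply, ι_pr_self]; rfl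

lemma pr_ι_of_ne_apply {i i' : ℕ} (hi : i' ≠ i) (j j' n : ℕ) (h' : i' + j' = n) (h : i + j = n)
    (x : (K.X i').X j') : pr K i j n h (ι K i' j' n h' x) = 0 := by
  rw [← ConcreteCategory.comp_apply, ι_pr_of_ne K hi]; rfl

/-- The horizontal part of the differential of the total complex. -/
noncomputable abbrev δ₁ (i j m : ℕ) : (K.X i).X j ⟶ (tot K).X m :=
  K.d₁ (ComplexShape.down ℕ) i j m

/-- The vertical part of the differential of the total complex. -/
noncomputable abbrev δ₂ (i j m : ℕ) : (K.X i).X j ⟶ (tot K).X m :=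
  K.d₂ (ComplexShape.down ℕ) i j m

lemma ι_d (i j n m : ℕ) (h : i + j = n) :
    ι K i j n h ≫ (tot K).d n m =
      δ₁ K i j m + δ₂ K i j m := by
  rw [total_d, Preadditive.comp_add, ι_D₁, ι_D₂]

lemma d₁_succ (i j m : ℕ) (h : i + j = m) :
    δ₁ K (i + 1) j m = (K.d (i + 1) i).f j ≫ ι K i j m h :=
  (K.d₁_eq (ComplexShape.down ℕ) (rfl : (ComplexShape.down ℕ).Rel (i + 1) i) j m h).trans
    (one_smul _ _)

lemma d₁_zero (j m : ℕ) : δ₁ K 0 j m = 0 :=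
  K.d₁_eq_zero _ _ _ _ (by simp)

lemma d₂_succ (i j m : ℕ) (h : i + j = m) :
    δ₂ K i (j + 1) m =
      (-1 : ℤ) ^ i • (K.X i).d (j + 1) j ≫ ι K i j m h :=
  (K.d₂_eq (ComplexShape.down ℕ) i (rfl : (ComplexShape.down ℕ).Rel (j + 1) j) m h).trans
    (by simp [Units.smul_def])

lemma d₂_zero (i m : ℕ) : δ₂ K i 0 m = 0 :=
  K.d₂_eq_zero _ _ _ _ (by simp)

/-- Both sides are compared on each summand; only `(i + 1, j)` and `(i, j + 1)` have a differential
into `(i, j)`. -/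
lemma d_pr (i j n m : ℕ) (h : i + j = m) (hn : m + 1 = n) :
    (tot K).d n m ≫ pr K i j m h =
      pr K (i + 1) j n (by lia) ≫ (K.d (i + 1) i).f j +
        (-1 : ℤ) ^ i • pr K i (j + 1) n (by lia) ≫ (K.X i).d (j + 1) j := by
  apply HomologicalComplex₂.total.hom_ext
  intro i' j' h'
  replace h' : i' + j' = n := h'
  rw [← Category.assoc, ι_d, Preadditive.comp_add, Preadditive.add_comp, Preadditive.comp_zsmul,
    ← Category.assoc, ← Category.assoc]
  congr 1
  · by_cases hi : i' = i + 1
    · subst hi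
      obtain rfl : j' = j := by lia
      rw [d₁_succ K i j' m h, Category.assoc, ι_pr_self, ι_pr_self, Category.comp_id,
        Category.id_comp]
    · rw [ι_pr_of_ne K hi, Limits.zero_comp]
      obtain _ | i' := i'
      · rw [d₁_zero, Limits.zero_comp]
      · rw [d₁_succ K i' j' m (by lia), Category.assoc, ι_pr_of_ne K (by lia), Limits.comp_zero]
  · by_cases hi : i' = i
    · subst hi
      obtain rfl : j' = j + 1 := by lia
      rw [d₂_succ K i' j m h, Preadditive.zsmul_comp, Category.assoc, ι_pr_self, ι_pr_self,
        Category.comp_id, Category.id_comp]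
    · rw [ι_pr_of_ne K hi, Limits.zero_comp, smul_zero]
      obtain _ | j' := j'
      · rw [d₂_zero, Limits.zero_comp]
      · rw [d₂_succ K i' j' m (by lia), Preadditive.zsmul_comp, Category.assoc,
          ι_pr_of_ne K (by lia), Limits.comp_zero, smul_zero]

lemma pr_d_apply (i j n m : ℕ) (h : i + j = m) (hn : m + 1 = n) (x : (tot K).X n) :
    pr K i j m h ((tot K).d n m x) =
      (K.d (i + 1) i).f j (pr K (i + 1) j n (by lia) x) +
        (-1 : ℤ) ^ i • (K.X i).d (j + 1) j (pr K i (j + 1) n (by lia) x) := by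
  rw [← ConcreteCategory.comp_apply, d_pr K i j n m h hn]
  rfl

/-! ### Filtrations of the total complex -/

/-- The filtration of the total complex by a function of the two indices. -/
noncomputable def weightFiltration (w : ℕ → ℕ → ℕ) (n : ℕ) (p : ℤ) : AddSubgroup ((tot K).X n) :=
  ⨆ (i : ℕ) (j : ℕ) (h : i + j = n) (_ : (w i j : ℤ) ≤ p), (ι K i j n h).hom.range

lemma ι_mem_weightFiltration (w : ℕ → ℕ → ℕ) {i j n : ℕ} (h : i + j = n) {p : ℤ}
    (hp : (w i j : ℤ) ≤ p) (x : (K.X i).X j) : ι K i j n h x ∈ weightFiltration K w n p :=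
  le_iSup_of_le (f := fun i => ⨆ (j : ℕ) (h : i + j = n) (_ : (w i j : ℤ) ≤ p),
    (ι K i j n h).hom.range) i
    (le_iSup_of_le j (le_iSup_of_le h (le_iSup_of_le hp le_rfl))) ⟨x, rfl⟩

lemma weightFiltration_le_iff {w : ℕ → ℕ → ℕ} {n : ℕ} {p : ℤ} {S : AddSubgroup ((tot K).X n)} :
    weightFiltration K w n p ≤ S ↔
      ∀ (i j : ℕ) (h : i + j = n) (_ : (w i j : ℤ) ≤ p) (x : (K.X i).X j), ι K i j n h x ∈ S := by
  simp only [weightFiltration, iSup_le_iff]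
  refine ⟨fun H i j h hp x => H i j h hp ⟨x, rfl⟩, ?_⟩
  rintro H i j h hp _ ⟨x, rfl⟩
  exact H i j h hp x

lemma d₁_mem_weightFiltration {w : ℕ → ℕ → ℕ} {i j n m : ℕ} (h : i + j = n) (hn : m + 1 = n)
    {p : ℤ} (hp : ∀ k, k + 1 = i → (w k j : ℤ) ≤ p) (x : (K.X i).X j) :
    δ₁ K i j m x ∈ weightFiltration K w m p := by
  obtain _ | i := i
  · rw [d₁_zero]
    exact zero_mem _
  · rw [d₁_succ K i j m (by lia)]
    exact ι_mem_weightFiltration K w _ (hp i rfl) _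

lemma d₂_mem_weightFiltration {w : ℕ → ℕ → ℕ} {i j n m : ℕ} (h : i + j = n) (hn : m + 1 = n)
    {p : ℤ} (hp : ∀ k, k + 1 = j → (w i k : ℤ) ≤ p) (x : (K.X i).X j) :
    δ₂ K i j m x ∈ weightFiltration K w m p := by
  obtain _ | j := j
  · rw [d₂_zero]
    exact zero_mem _
  · rw [d₂_succ K i j m (by lia)]
    exact zsmul_mem (ι_mem_weightFiltration K w (by lia) (hp j rfl) _) _

/-- One argument serves both filtrations: `hw` bounds the weight by the total degree, and `h₁`, `h₂`
say that neither differential raises it. -/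
lemma weightFiltration_isFirstQuadrant {w : ℕ → ℕ → ℕ} (hw : ∀ i j, w i j ≤ i + j)
    (h₁ : ∀ i j, w i j ≤ w (i + 1) j) (h₂ : ∀ i j, w i j ≤ w i (j + 1)) :
    FilteredComplex.IsFirstQuadrant (tot K) (weightFiltration K w) where
  mono n p p' h := (weightFiltration_le_iff K).2 fun i j hij hp x =>
    ι_mem_weightFiltration K w hij (hp.trans h) x
  bot n := by
    rw [eq_bot_iff, weightFiltration_le_iff]
    intro i j h hp
    lia
  top n := by
    rw [eq_top_iff]
    intro x _
    -- The quotient by `F_n` vanishes on every summand, hence on the total complex.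
    have : AddCommGrpCat.ofHom (QuotientAddGroup.mk' (weightFiltration K w n n)) = 0 := by
      apply HomologicalComplex₂.total.hom_ext
      intro i j h
      replace h : i + j = n := h
      ext y
      rw [Limits.comp_zero]
      exact (QuotientAddGroup.eq_zero_iff _).2
        (ι_mem_weightFiltration K w h (by have := hw i j; lia) y)
    exact (QuotientAddGroup.eq_zero_iff _).1 (ConcreteCategory.congr_hom this x)
  d_mem n m p x hx := by
    by_cases hn : m + 1 = n
    · suffices weightFiltration K w n p ≤ (weightFiltration K w m p).comap ((tot K).d n m).hom from
        this hx
      rw [weightFiltration_le_iff]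
      intro i j h hp y
      change (tot K).d n m (ι K i j n h y) ∈ weightFiltration K w m p
      rw [← ConcreteCategory.comp_apply, ι_d]
      refine add_mem (d₁_mem_weightFiltration K h hn ?_ y) (d₂_mem_weightFiltration K h hn ?_ y)
      · rintro k rfl
        have := h₁ k j
        lia
      · rintro k rfl
        have := h₂ i k
        lia
    · rw [AbComplex.d_apply_of_not_rel _ hn]
      exact zero_mem _

lemma filtration₁_eq : filtration₁ K = weightFiltration K fun i _ => i := rfl

lemma filtration₁_isFirstQuadrant : FilteredComplex.IsFirstQuadrant (tot K) (filtration₁ K) :=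
  weightFiltration_isFirstQuadrant K (fun _ _ => by lia) (fun _ _ => by lia) fun _ _ => le_rfl

lemma filtration₂_isFirstQuadrant : FilteredComplex.IsFirstQuadrant (tot K) (filtration₂ K) :=
  weightFiltration_isFirstQuadrant K (fun _ _ => by lia) (fun _ _ => le_rfl) fun _ _ => by lia

lemma pr_eq_zero {i j n : ℕ} (h : i + j = n) {p : ℤ} (hp : p < i) {x : (tot K).X n}
    (hx : x ∈ filtration₁ K n p) : pr K i j n h x = 0 := by
  suffices filtration₁ K n p ≤ (pr K i j n h).hom.ker from this hx
  rw [filtration₁_eq, weightFiltration_le_iff]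
  intro i' j' h' hp' y
  exact pr_ι_of_ne_apply K (by lia) _ _ _ _ _ y

/-- In a fixed total degree the first index `i` occurs in a single summand, so removing that
component lowers the filtration degree. -/
lemma sub_ι_pr_mem {i j n : ℕ} (h : i + j = n) {x : (tot K).X n}
    (hx : x ∈ filtration₁ K n i) :
    x - ι K i j n h (pr K i j n h x) ∈ filtration₁ K n (i - 1) := by
  suffices filtration₁ K n i ≤ (filtration₁ K n (i - 1)).comap
    (AddMonoidHom.id _ - (pr K i j n h ≫ ι K i j n h).hom) from this hx
  rw [filtration₁_eq, weightFiltration_le_iff]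
  intro i' j' h' hp' y
  change ι K i' j' n h' y - ι K i j n h (pr K i j n h (ι K i' j' n h' y)) ∈
    weightFiltration K (fun i _ => i) n (i - 1)
  by_cases hi : i' = i
  · subst hi
    obtain rfl : j' = j := by lia
    rw [pr_ι_self_apply, sub_self]
    exact zero_mem _
  · rw [pr_ι_of_ne_apply K hi, map_zero, sub_zero]
    exact ι_mem_weightFiltration K _ h' (by lia) y

end DoubleComplex

/-! ### The second page of the spectral sequence of a double complex -/

namespace DoubleComplex

open HomologicalComplex₂ FilteredComplex

variable (K : HomologicalComplex₂ AddCommGrpCat.{u} (ComplexShape.down ℕ) (ComplexShape.down ℕ))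

/-- The complex of the homology groups in degree `q` of the columns of a double complex. -/
noncomputable abbrev columnHomology (q : ℕ) : ChainComplex AddCommGrpCat.{u} ℕ :=
  ((HomologicalComplex.homologyFunctor AddCommGrpCat.{u} (ComplexShape.down ℕ) q).mapHomologicalComplex
    (ComplexShape.down ℕ)).obj K

/-- The class of a vertical cycle in the complex of homology groups of the columns. -/
noncomputable def columnClass (q i : ℕ) :
    AbComplex.cycleSubgroup (K.X i) q →+ (columnHomology K q).X i :=
  AbComplex.homologyClass (K.X i) q

lemma columnClass_surjective (q i : ℕ) : Function.Surjective (columnClass K q i) :=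
  AbComplex.homologyClass_surjective (K.X i) q

lemma columnClass_eq_zero_iff (q i : ℕ) (x : AbComplex.cycleSubgroup (K.X i) q) :
    columnClass K q i x = 0 ↔ ∃ y : (K.X i).X (q + 1), (K.X i).d (q + 1) q y = x := by
  refine (AbComplex.homologyClass_eq_zero_iff (K.X i) q x).trans ⟨?_, fun ⟨y, hy⟩ => ⟨_, y, hy⟩⟩
  rintro ⟨k, y, hy⟩
  by_cases hk : q + 1 = k
  · subst hk
    exact ⟨y, hy⟩
  · rw [AbComplex.d_apply_of_not_rel _ hk] at hy
    exact ⟨0, (map_zero _).trans hy⟩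

lemma columnHomology_d_class (q i j : ℕ) (x : AbComplex.cycleSubgroup (K.X i) q) :
    (columnHomology K q).d i j (columnClass K q i x) =
      columnClass K q j ⟨(K.d i j).f q x, AbComplex.f_mem_cycleSubgroup (K.d i j) x.2⟩ :=
  AbComplex.homologyMap_homologyClass (K.d i j) q x

/-! ### Leading components of the elements of `Z^2`. -/

variable {K}

lemma neg_one_pow_smul_smul {G : Type*} [AddCommGroup G] (k : ℕ) (x : G) :
    (-1 : ℤ) ^ k • (-1 : ℤ) ^ k • x = x := by
  rw [smul_smul, ← mul_pow, neg_one_mul, neg_neg, one_pow, one_smul]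

/-- In the component of `∂x` at first index `p` the horizontal term vanishes because `x ∈ F_p`, and
the whole component vanishes because `∂x ∈ F_{p-2}`. -/
lemma pr_mem_cycleSubgroup {p q n : ℕ} (h : p + q = n) {x : (tot K).X n}
    (hx : x ∈ approxCycles (tot K) (filtration₁ K) 2 p n) :
    pr K p q n h x ∈ AbComplex.cycleSubgroup (K.X p) q := by
  rw [mem_approxCycles] at hx
  rw [AbComplex.mem_cycleSubgroup]
  intro j
  by_cases hj : j + 1 = q
  · subst hj
    have h₁ := pr_d_apply K p j n (p + j) rfl (by lia) x
    rw [pr_eq_zero K _ (p := p - 2) (by lia) (hx.2 _), pr_eq_zero K (i := p + 1) _ (by lia) hx.1,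
      map_zero, zero_add, eq_comm] at h₁
    rw [← neg_one_pow_smul_smul p (DFunLike.coe _ _), h₁, smul_zero]
  · exact AbComplex.d_apply_of_not_rel _ hj _

/-- The map from `Z²_p` to the homology of the column that takes the leading component. -/
noncomputable def leadingClass (p q n : ℕ) (h : p + q = n) :
    approxCycles (tot K) (filtration₁ K) 2 p n →+ (columnHomology K q).X p :=
  (columnClass K q p).comp
    (((pr K p q n h).hom.comp (AddSubgroup.subtype _)).codRestrict _
      fun x => pr_mem_cycleSubgroup h x.2)

lemma leadingClass_apply {p q n : ℕ} (h : p + q = n)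
    (x : approxCycles (tot K) (filtration₁ K) 2 p n) :
    leadingClass p q n h x =
      columnClass K q p ⟨_, pr_mem_cycleSubgroup h x.2⟩ := rfl

/-- The component of `∂x` at first index `p - 1` is zero too. It says that the horizontal boundary
of the leading component is, up to sign, the vertical boundary of the next component of `x`. -/
lemma leadingClass_mem_cycleSubgroup {p q n : ℕ} (h : p + q = n)
    (x : approxCycles (tot K) (filtration₁ K) 2 p n) :
    leadingClass p q n h x ∈ AbComplex.cycleSubgroup (columnHomology K q) p := by
  rw [AbComplex.mem_cycleSubgroup]
  intro i
  by_cases hi : i + 1 = p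
  · subst hi
    rw [leadingClass_apply, columnHomology_d_class, columnClass_eq_zero_iff]
    have h₁ := pr_d_apply K i q n (i + q) rfl (by lia) x
    rw [pr_eq_zero K _ (p := (i + 1 : ℕ) - 2) (by lia) ((mem_approxCycles.1 x.2).2 _), eq_comm,
      add_eq_zero_iff_eq_neg] at h₁
    refine ⟨-((-1 : ℤ) ^ i • pr K i (q + 1) n (by lia) x), ?_⟩
    rw [map_neg, map_zsmul]
    exact h₁.symm
  · exact AbComplex.d_apply_of_not_rel _ hi _

/-- The map from `Z²_p` to the homology of the complex of homology groups of the columns. -/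
noncomputable def secondPageClass (p q n : ℕ) (h : p + q = n) :
    approxCycles (tot K) (filtration₁ K) 2 p n →+ (columnHomology K q).homology p :=
  (AbComplex.homologyClass (columnHomology K q) p).comp
    ((leadingClass p q n h).codRestrict _ (leadingClass_mem_cycleSubgroup h))

lemma secondPageClass_apply {p q n : ℕ} (h : p + q = n)
    (x : approxCycles (tot K) (filtration₁ K) 2 p n) :
    secondPageClass p q n h x =
      AbComplex.homologyClass (columnHomology K q) p
        ⟨_, leadingClass_mem_cycleSubgroup h x⟩ := rfl

lemma ι_d_apply (i j n m : ℕ) (h : i + j = n) (x : (K.X i).X j) :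
    (tot K).d n m (ι K i j n h x) =
      δ₁ K i j m x + δ₂ K i j m x := by
  rw [← ConcreteCategory.comp_apply, ι_d]
  rfl

lemma d₁_succ_apply (i j m : ℕ) (h : i + j = m) (x : (K.X (i + 1)).X j) :
    δ₁ K (i + 1) j m x = ι K i j m h ((K.d (i + 1) i).f j x) := by
  rw [d₁_succ K i j m h]
  rfl

lemma d₂_succ_apply (i j m : ℕ) (h : i + j = m) (x : (K.X i).X (j + 1)) :
    δ₂ K i (j + 1) m x =
      (-1 : ℤ) ^ i • ι K i j m h ((K.X i).d (j + 1) j x) := by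
  rw [d₂_succ K i j m h]
  rfl

lemma d₂_succ_smul_apply (i j m : ℕ) (h : i + j = m) (x : (K.X i).X (j + 1)) :
    δ₂ K i (j + 1) m ((-1 : ℤ) ^ i • x) = ι K i j m h ((K.X i).d (j + 1) j x) := by
  rw [map_zsmul, d₂_succ_apply i j m h, neg_one_pow_smul_smul]

lemma d₂_apply_eq_zero {i j n m : ℕ} (h : i + j = n) (hm : m + 1 = n) {x : (K.X i).X j}
    (hx : x ∈ AbComplex.cycleSubgroup (K.X i) j) :
    δ₂ K i j m x = 0 := by
  obtain _ | j := j
  · rw [d₂_zero]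
    rfl
  · rw [d₂_succ_apply i j m (by lia), (AbComplex.mem_cycleSubgroup _).1 hx, map_zero, smul_zero]

/-- This is one step of a zigzag: the horizontal boundary of `v` is a vertical boundary, and
subtracting the chain that it bounds pushes the total boundary two filtration steps down. -/
lemma secondPageClass_surjective (p q n : ℕ) (h : p + q = n) :
    Function.Surjective (secondPageClass (K := K) p q n h) := by
  intro y
  obtain ⟨⟨y, hy⟩, rfl⟩ := AbComplex.homologyClass_surjective _ _ y
  obtain ⟨v, rfl⟩ := columnClass_surjective K q p y
  suffices ∃ x ∈ approxCycles (tot K) (filtration₁ K) 2 p n, pr K p q n h x = v by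
    obtain ⟨x, hx, hxv⟩ := this
    exact ⟨⟨x, hx⟩, congrArg (AbComplex.homologyClass _ _)
      (Subtype.ext (congrArg (columnClass K q p) (Subtype.ext hxv)))⟩
  rw [AbComplex.mem_cycleSubgroup] at hy
  obtain _ | p := p
  · refine ⟨ι K 0 q n h v, mem_approxCycles.2
      ⟨ι_mem_weightFiltration K _ h le_rfl _, fun m => ?_⟩, pr_ι_self_apply K 0 q n h v.1⟩
    by_cases hm : m + 1 = n
    · rw [ι_d_apply, d₁_zero, d₂_apply_eq_zero h hm v.2, add_zero]
      exact zero_mem _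
    · rw [AbComplex.d_apply_of_not_rel _ hm]
      exact zero_mem _
  · have hy' := hy p
    rw [columnHomology_d_class, columnClass_eq_zero_iff] at hy'
    obtain ⟨w, hw⟩ := hy'
    replace hw : (K.X p).d (q + 1) q w = (K.d (p + 1) p).f q v := hw
    have h' : p + (q + 1) = n := by lia
    -- The factor `(-1)^p` on `w` cancels the sign of the vertical differential in the total
    -- complex.
    refine ⟨ι K (p + 1) q n h v - ι K p (q + 1) n h' ((-1 : ℤ) ^ p • w), mem_approxCycles.2
      ⟨sub_mem (ι_mem_weightFiltration K _ h le_rfl _)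
        (ι_mem_weightFiltration K _ h' (by lia) _), fun m => ?_⟩, ?_⟩
    · by_cases hm : m + 1 = n
      · rw [map_sub, ι_d_apply, ι_d_apply, d₂_apply_eq_zero h hm v.2,
          d₁_succ_apply p q m (by lia), d₂_succ_smul_apply p q m (by lia), hw, add_zero, sub_add_cancel_right]
        exact neg_mem (d₁_mem_weightFiltration K h' hm (by rintro k rfl; lia) _)
      · rw [AbComplex.d_apply_of_not_rel _ hm]
        exact zero_mem _
    · rw [map_sub, pr_ι_self_apply, pr_ι_of_ne_apply K (by lia), sub_zero]

/-- If the leading component is the horizontal boundary of `u'` plus the vertical boundary of `u`,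
then `b`, assembled from `u'` and `± u`, satisfies `x - ∂b ∈ F_{p-1}`. Conversely, if `x = a + ∂b`
with `a ∈ F_{p-1}` and `b ∈ Z^1_{p+1}`, the top component of `b` is a vertical cycle, and its
horizontal boundary represents the leading class of `x`. -/
lemma secondPageClass_eq_zero_iff (p q n : ℕ) (h : p + q = n)
    (x : approxCycles (tot K) (filtration₁ K) 2 p n) :
    secondPageClass p q n h x = 0 ↔
      (x : (tot K).X n) ∈ approxBoundaries (tot K) (filtration₁ K) 2 p n := by
  have hx := mem_approxCycles.1 x.2
  have hF := filtration₁_isFirstQuadrant K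
  rw [secondPageClass_apply, AbComplex.homologyClass_eq_zero_iff]
  constructor
  · intro H
    obtain ⟨u', hu', u, hu⟩ : ∃ u' : (K.X (p + 1)).X q,
        u' ∈ AbComplex.cycleSubgroup (K.X (p + 1)) q ∧ ∃ u : (K.X p).X (q + 1),
        (K.X p).d (q + 1) q u = pr K p q n h x - (K.d (p + 1) p).f q u' := by
      obtain ⟨u', hu'⟩ : ∃ u' : AbComplex.cycleSubgroup (K.X (p + 1)) q,
          (columnHomology K q).d (p + 1) p (columnClass K q (p + 1) u') =
            leadingClass p q n h x := by
        obtain ⟨k, y, hy⟩ := H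
        by_cases hk : p + 1 = k
        · subst hk
          obtain ⟨u', rfl⟩ := columnClass_surjective K q (p + 1) y
          exact ⟨u', hy⟩
        · rw [AbComplex.d_apply_of_not_rel _ hk] at hy
          exact ⟨0, by rw [map_zero, map_zero]; exact hy⟩
      refine ⟨u', u'.2, ?_⟩
      rw [columnHomology_d_class, leadingClass_apply, eq_comm, ← sub_eq_zero, ← map_sub,
        columnClass_eq_zero_iff] at hu'
      exact hu'
    have h₁ : p + 1 + q = n + 1 := by lia
    have h₂ : p + (q + 1) = n + 1 := by lia
    set b : (tot K).X (n + 1) := ι K (p + 1) q (n + 1) h₁ u' +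
      ι K p (q + 1) (n + 1) h₂ ((-1 : ℤ) ^ p • u) with hb
    have hdb : (tot K).d (n + 1) n b = ι K p q n h (pr K p q n h x) +
        δ₁ K p (q + 1) n ((-1 : ℤ) ^ p • u) := by
      rw [hb, map_add, ι_d_apply, ι_d_apply, d₂_apply_eq_zero h₁ rfl hu', add_zero,
        d₁_succ_apply p q n h, d₂_succ_smul_apply p q n h, hu, map_sub]
      abel
    have hd₁ : δ₁ K p (q + 1) n ((-1 : ℤ) ^ p • u) ∈
        filtration₁ K n (p - 1) :=
      d₁_mem_weightFiltration K h₂ rfl (by rintro k rfl; lia) _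
    refine mem_approxBoundaries.2 ⟨(x : (tot K).X n) - (tot K).d (n + 1) n b,
      mem_approxCycles.2 ⟨?_, fun m => ?_⟩, n + 1, b, mem_approxCycles.2 ⟨?_, fun m => ?_⟩,
      sub_add_cancel _ _⟩
    · rw [hdb, ← sub_sub]
      exact sub_mem (sub_ι_pr_mem K h hx.1) hd₁
    · rw [map_sub, AbComplex.d_d_apply, sub_zero]
      exact hF.mono _ (by lia) (hx.2 m)
    · exact add_mem (ι_mem_weightFiltration K _ h₁ (by lia) _)
        (ι_mem_weightFiltration K _ h₂ (by lia) _)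
    · by_cases hm : m = n
      · subst hm
        rw [hdb]
        exact hF.mono _ (by lia : (p : ℤ) ≤ _) (add_mem (ι_mem_weightFiltration K _ h le_rfl _)
          (hF.mono _ (by lia) hd₁))
      · rw [AbComplex.d_apply_of_not_rel _ (by simp; lia)]
        exact zero_mem _
  · intro H
    obtain ⟨a, ha, m, b, hb, hab⟩ := mem_approxBoundaries.1 H
    rw [mem_approxCycles] at ha hb
    by_cases hm : n + 1 = m
    · subst hm
      have hcyc : pr K (p + 1) q (n + 1) (by lia) b ∈ AbComplex.cycleSubgroup (K.X (p + 1)) q := by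
        rw [AbComplex.mem_cycleSubgroup]
        intro j
        by_cases hj : j + 1 = q
        · subst hj
          have h₁ := pr_d_apply K (p + 1) j (n + 1) n (by lia) (by lia) b
          rw [pr_eq_zero K _ (p := p + 2 - 1 - (2 - 1)) (by lia) (hb.2 _),
            pr_eq_zero K (i := p + 1 + 1) _ (by lia) hb.1,
            map_zero, zero_add, eq_comm] at h₁
          rw [← neg_one_pow_smul_smul (p + 1) (DFunLike.coe _ _), h₁, smul_zero]
        · exact AbComplex.d_apply_of_not_rel _ hj _
      refine ⟨p + 1, columnClass K q (p + 1) ⟨_, hcyc⟩, ?_⟩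
      rw [columnHomology_d_class]
      change _ = leadingClass p q n h x
      rw [leadingClass_apply, eq_comm, ← sub_eq_zero, ← map_sub,
        columnClass_eq_zero_iff]
      refine ⟨(-1 : ℤ) ^ p • pr K p (q + 1) (n + 1) (by lia) b, ?_⟩
      change _ = pr K p q n h x - (K.d (p + 1) p).f q (pr K (p + 1) q (n + 1) _ b)
      rw [← hab, map_add, pr_eq_zero K h (by lia) ha.1, pr_d_apply K p q (n + 1) n h rfl, zero_add,
        add_sub_cancel_left, map_zsmul]
    · rw [AbComplex.d_apply_of_not_rel _ hm, add_zero] at hab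
      refine ⟨p, 0, ?_⟩
      rw [map_zero, eq_comm]
      change leadingClass p q n h x = 0
      rw [leadingClass_apply, columnClass_eq_zero_iff]
      refine ⟨0, ?_⟩
      rw [map_zero, eq_comm]
      change pr K p q n h x = 0
      rw [← hab]
      exact pr_eq_zero K h (by lia) ha.1

variable (K) in
/-- The second page of the spectral sequence of a double complex filtered by the first index is the
homology of the complex of homology groups of the columns. -/
noncomputable def secondPageEquiv (p q n : ℕ) (h : p + q = n) :
    pageX (tot K) (filtration₁ K) 2 p n ≃+ (columnHomology K q).homology p :=
  AddEquiv.ofSurjectives (QuotientAddGroup.mk' _) (secondPageClass p q n h)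
    (QuotientAddGroup.mk'_surjective _) (secondPageClass_surjective p q n h)
    fun z => (mk_eq_zero_iff z).trans (secondPageClass_eq_zero_iff p q n h z).symm

end DoubleComplex

/-! ### Pages under maps of filtered complexes. -/

namespace FilteredComplex

variable {K K' : ChainComplex AddCommGrpCat.{u} ℕ} {F : ∀ n : ℕ, ℤ → AddSubgroup (K.X n)}
  {F' : ∀ n : ℕ, ℤ → AddSubgroup (K'.X n)}

lemma map_mem_approxCycles (f : K ⟶ K')
    (hf : ∀ n p x, x ∈ F n p → f.f n x ∈ F' n p) {r p : ℤ} {n : ℕ} {x : K.X n}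
    (hx : x ∈ approxCycles K F r p n) : f.f n x ∈ approxCycles K' F' r p n := by
  rw [mem_approxCycles] at hx ⊢
  refine ⟨hf _ _ _ hx.1, fun m => ?_⟩
  rw [AbComplex.f_d_apply]
  exact hf _ _ _ (hx.2 m)

lemma map_mem_approxBoundaries (f : K ⟶ K')
    (hf : ∀ n p x, x ∈ F n p → f.f n x ∈ F' n p) {r p : ℤ} {n : ℕ} {x : K.X n}
    (hx : x ∈ approxBoundaries K F r p n) : f.f n x ∈ approxBoundaries K' F' r p n := by
  rw [mem_approxBoundaries] at hx ⊢
  obtain ⟨y, hy, m, z, hz, rfl⟩ := hx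
  refine ⟨_, map_mem_approxCycles f hf hy, m, _, map_mem_approxCycles f hf hz, ?_⟩
  rw [map_add, AbComplex.f_d_apply]

/-- An isomorphism of filtered complexes induces isomorphisms of the pages. -/
noncomputable def pageXEquiv (e : K ≅ K') (h : ∀ n p x, x ∈ F n p → e.hom.f n x ∈ F' n p)
    (h' : ∀ n p x, x ∈ F' n p → e.inv.f n x ∈ F n p) (r p : ℤ) (n : ℕ) :
    pageX K F r p n ≃+ pageX K' F' r p n :=
  have hi (n : ℕ) (x : K.X n) : e.inv.f n (e.hom.f n x) = x := by
    rw [← ConcreteCategory.comp_apply, ← HomologicalComplex.comp_f, e.hom_inv_id]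
    rfl
  have hi' (n : ℕ) (x : K'.X n) : e.hom.f n (e.inv.f n x) = x := by
    rw [← ConcreteCategory.comp_apply, ← HomologicalComplex.comp_f, e.inv_hom_id]
    rfl
  AddEquiv.ofSurjectives (QuotientAddGroup.mk' _)
    ((QuotientAddGroup.mk' _).comp (((e.hom.f n).hom.comp (AddSubgroup.subtype _)).codRestrict
      (approxCycles K' F' r p n) fun x => map_mem_approxCycles e.hom h x.2))
    (QuotientAddGroup.mk'_surjective _)
    (fun y => by
      obtain ⟨y, rfl⟩ := QuotientAddGroup.mk_surjective y
      exact ⟨⟨_, map_mem_approxCycles e.inv h' y.2⟩,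
        congrArg QuotientAddGroup.mk (Subtype.ext (hi' n y))⟩)
    (fun x => by
      refine (mk_eq_zero_iff x).trans (Iff.trans ?_ (mk_eq_zero_iff _).symm)
      refine ⟨fun hx => map_mem_approxBoundaries e.hom h hx, fun hx => ?_⟩
      rw [← hi n x]
      exact map_mem_approxBoundaries e.inv h' hx)

end FilteredComplex

/-! ### The second filtration -/

/-- The signs of the symmetry of the total complex of a double complex in the first quadrant. -/
instance TotalComplexShapeSymmetry.downNat : TotalComplexShapeSymmetry (ComplexShape.down ℕ)
    (ComplexShape.down ℕ) (ComplexShape.down ℕ) where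
  symm p q := add_comm q p
  σ p q := (-1) ^ (p * q)
  σ_ε₁ := by
    rintro _ p rfl q
    change (-1 : ℤˣ) ^ ((p + 1) * q) * 1 = (-1) ^ q * (-1) ^ (p * q)
    rw [mul_one, ← pow_add, add_mul, one_mul, add_comm]
  σ_ε₂ := by
    rintro p _ q rfl
    change (-1 : ℤˣ) ^ (p * (q + 1)) * (-1) ^ p = 1 * (-1) ^ (p * q)
    rw [one_mul, ← pow_add, mul_add, mul_one, add_assoc, pow_add, ← two_mul, pow_mul]
    simp

namespace DoubleComplex

open HomologicalComplex₂ FilteredComplex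

variable (K : HomologicalComplex₂ AddCommGrpCat.{u} (ComplexShape.down ℕ) (ComplexShape.down ℕ))

/-- The flip sends the summand `(i, j)` to `(j, i)` up to sign, so it exchanges the two filtrations.
-/
lemma totalFlipIso_hom_mem (n : ℕ) (p : ℤ) (x : (tot K.flip).X n)
    (hx : x ∈ filtration₁ K.flip n p) :
    (K.totalFlipIso (ComplexShape.down ℕ)).hom.f n x ∈ filtration₂ K n p := by
  suffices weightFiltration K.flip (fun i _ => i) n p ≤ (filtration₂ K n p).comap
    ((K.totalFlipIso (ComplexShape.down ℕ)).hom.f n).hom from this hx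
  rw [weightFiltration_le_iff]
  intro i j h hp y
  change (K.totalFlipIso (ComplexShape.down ℕ)).hom.f n
    (K.flip.ιTotal (ComplexShape.down ℕ) i j n h y) ∈ filtration₂ K n p
  rw [← ConcreteCategory.comp_apply, ιTotal_totalFlipIso_f_hom, Units.smul_def]
  exact zsmul_mem (ι_mem_weightFiltration K (fun _ j => j) (by lia) hp y) _

lemma totalFlipIso_inv_mem (n : ℕ) (p : ℤ) (x : (tot K).X n)
    (hx : x ∈ filtration₂ K n p) :
    (K.totalFlipIso (ComplexShape.down ℕ)).inv.f n x ∈ filtration₁ K.flip n p := by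
  suffices weightFiltration K (fun _ j => j) n p ≤ (filtration₁ K.flip n p).comap
    ((K.totalFlipIso (ComplexShape.down ℕ)).inv.f n).hom from this hx
  rw [weightFiltration_le_iff]
  intro i j h hp y
  change (K.totalFlipIso (ComplexShape.down ℕ)).inv.f n
    (K.ιTotal (ComplexShape.down ℕ) i j n h y) ∈ filtration₁ K.flip n p
  rw [← ConcreteCategory.comp_apply, ιTotal_totalFlipIso_f_inv, Units.smul_def]
  exact zsmul_mem (ι_mem_weightFiltration K.flip (fun i _ => i) (by lia) hp y) _

/-- The second page of the spectral sequence of a double complex filtered by the second index is the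
homology of the complex of homology groups of the rows. -/
noncomputable def secondPageEquivFlip (p q n : ℕ) (h : p + q = n) :
    pageX (tot K) (filtration₂ K) 2 q n ≃+ (columnHomology K.flip p).homology q :=
  (pageXEquiv (K.totalFlipIso (ComplexShape.down ℕ)) (totalFlipIso_hom_mem K)
    (totalFlipIso_inv_mem K) 2 q n).symm.trans (secondPageEquiv K.flip q p n (by lia))

end DoubleComplex

/-! ### Homology of coproducts of complexes of abelian groups -/

namespace AbComplex

open Limits

section Coproducts

variable {I : Type u} {X : I → AddCommGrpCat.{u}} {Y : AddCommGrpCat.{u}} {ι : ∀ i, X i ⟶ Y}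
  {π : ∀ i, Y ⟶ X i}

/-- An element of a coproduct of abelian groups is the sum of its components. -/
lemma exists_finset_sum_components (hY : IsColimit (Cofan.mk Y ι))
    (h₁ : ∀ i, ι i ≫ π i = 𝟙 _) (h₂ : ∀ i j, i ≠ j → ι i ≫ π j = 0) (y : Y) :
    ∃ s : Finset I, y = ∑ i ∈ s, ι i (π i y) := by
  classical
  have h₁' (i : I) (x : X i) : π i (ι i x) = x := by
    rw [← ConcreteCategory.comp_apply, h₁]; rfl
  have h₂' (i j : I) (h : i ≠ j) (x : X i) : π j (ι i x) = 0 := by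
    rw [← ConcreteCategory.comp_apply, h₂ i j h]; rfl
  have htop : (⨆ i, (ι i).hom.range) = ⊤ := by
    rw [eq_top_iff]
    intro y _
    have : AddCommGrpCat.ofHom (QuotientAddGroup.mk' (⨆ i, (ι i).hom.range)) = 0 := by
      refine Cofan.IsColimit.hom_ext hY _ _ fun i => ?_
      ext x
      exact (QuotientAddGroup.eq_zero_iff _).2
        (le_iSup (fun i => (ι i).hom.range) i ⟨x, rfl⟩)
    exact (QuotientAddGroup.eq_zero_iff _).1 (ConcreteCategory.congr_hom this y)
  have hy : y ∈ ⨆ i, (ι i).hom.range := htop ▸ AddSubgroup.mem_top y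
  -- The vanishing of the components outside `s` is added for the induction: it allows both sums to
  -- be extended to `s ∪ t`.
  suffices ∃ s : Finset I, y = ∑ i ∈ s, ι i (π i y) ∧ ∀ i ∉ s, π i y = 0 from
    this.imp fun s hs => hs.1
  induction hy using AddSubgroup.iSup_induction' with
  | hp i x hx =>
    obtain ⟨x, rfl⟩ := hx
    refine ⟨{i}, ?_, fun j hj => h₂' i j (by simpa [eq_comm] using hj) x⟩
    rw [Finset.sum_singleton]
    exact congrArg (ι i) (h₁' i x).symm
  | h1 => exact ⟨∅, by simp, fun i _ => map_zero _⟩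
  | hadd x y _ _ hx hy =>
    obtain ⟨s, hs, hs'⟩ := hx
    obtain ⟨t, ht, ht'⟩ := hy
    refine ⟨s ∪ t, ?_, fun i hi => ?_⟩
    · simp only [map_add, Finset.sum_add_distrib]
      congr 1
      · refine hs.trans (Finset.sum_subset Finset.subset_union_left fun i _ hi => ?_)
        rw [hs' i hi, map_zero]
      · refine ht.trans (Finset.sum_subset Finset.subset_union_right fun i _ hi => ?_)
        rw [ht' i hi, map_zero]
    · rw [Finset.mem_union, not_or] at hi
      rw [map_add, hs' i hi.1, ht' i hi.2, add_zero]

end Coproducts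

variable {J : Type*} {c : ComplexShape J} {I : Type u}
  {M : I → HomologicalComplex AddCommGrpCat.{u} c} {N : HomologicalComplex AddCommGrpCat.{u} c}

/-- Homology commutes with coproducts of complexes of abelian groups. -/
lemma isIso_desc_homologyMap (ι : ∀ i, M i ⟶ N)
    (hN : ∀ n, IsColimit (Cofan.mk (N.X n) fun i => (ι i).f n)) (n : J) :
    IsIso (Sigma.desc fun i => HomologicalComplex.homologyMap (ι i) n :
      (∐ fun i => (M i).homology n) ⟶ N.homology n) := by
  classical
  have hN' : IsColimit (Cofan.mk N ι) := HomologicalComplex.isColimitOfEval _ _ fun n =>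
    (isColimitMapCoconeCofanMkEquiv (HomologicalComplex.eval AddCommGrpCat.{u} c n) M ι).symm (hN n)
  -- The projections are chain maps, so they act on homology and detect the components there.
  set π : ∀ i, N ⟶ M i := fun i => Cofan.IsColimit.desc hN'
    fun j => if h : j = i then eqToHom (congrArg M h) else 0
  have h₁ (i : I) : ι i ≫ π i = 𝟙 _ := by
    refine (Cofan.IsColimit.fac hN' _ i).trans ?_
    simp
  have h₂ (i j : I) (h : i ≠ j) : ι i ≫ π j = 0 := by
    refine (Cofan.IsColimit.fac hN' _ i).trans ?_
    simp [h]
  set f := (Sigma.desc fun i => HomologicalComplex.homologyMap (ι i) n :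
    (∐ fun i => (M i).homology n) ⟶ N.homology n)
  have hf (i : I) : Sigma.ι (fun i => (M i).homology n) i ≫ f =
      HomologicalComplex.homologyMap (ι i) n := Sigma.ι_desc _ _
  have hfπ (i : I) : f ≫ HomologicalComplex.homologyMap (π i) n =
      Sigma.π (fun i => (M i).homology n) i := by
    refine Sigma.hom_ext _ _ fun j => ?_
    rw [← Category.assoc, hf, ← HomologicalComplex.homologyMap_comp]
    by_cases hj : j = i
    · subst hj
      rw [h₁, HomologicalComplex.homologyMap_id, Sigma.ι_π_eq_id]
    · rw [h₂ j i hj, HomologicalComplex.homologyMap_zero, Sigma.ι_π_of_ne _ hj]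
  have hinj : Function.Injective f := by
    rw [injective_iff_map_eq_zero]
    intro x hx
    obtain ⟨s, hs⟩ := exists_finset_sum_components
      (π := Sigma.π fun i => (M i).homology n) (coproductIsCoproduct fun i => (M i).homology n)
      (fun i => Sigma.ι_π_eq_id _ i) (fun i j h => Sigma.ι_π_of_ne _ h) x
    rw [hs]
    refine Finset.sum_eq_zero fun i _ => ?_
    rw [← hfπ i, ConcreteCategory.comp_apply, hx, map_zero, map_zero]
  -- A cycle is the finite sum of its components, and each component is a cycle because the
  -- projections are chain maps.
  have hsurj : Function.Surjective f := by
    intro y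
    obtain ⟨⟨y, hy⟩, rfl⟩ := homologyClass_surjective N n y
    obtain ⟨s, hs⟩ := exists_finset_sum_components (hN n)
      (π := fun i => (π i).f n) (fun i => by rw [← HomologicalComplex.comp_f, h₁]; rfl)
      (fun i j h => by rw [← HomologicalComplex.comp_f, h₂ i j h]; rfl) y
    refine ⟨∑ i ∈ s, Sigma.ι (fun i => (M i).homology n) i
      (homologyClass (M i) n ⟨(π i).f n y, f_mem_cycleSubgroup (π i) hy⟩), ?_⟩
    rw [map_sum]
    have hfi (i : I) (x : (M i).homology n) : f (Sigma.ι (fun i => (M i).homology n) i x) =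
        HomologicalComplex.homologyMap (ι i) n x := by
      rw [← ConcreteCategory.comp_apply, hf]
    simp only [hfi, homologyMap_homologyClass]
    rw [← map_sum]
    congr 1
    refine Subtype.ext ?_
    rw [AddSubgroup.val_finsetSum]
    exact hs.symm
  exact (ConcreteCategory.isIso_iff_bijective f).2 ⟨hinj, hsurj⟩

end AbComplex

/-! ### Decomposition of simplicial sets into nerves -/

namespace SmallCat

open Limits

section Decomposition

variable (A : AddCommGrpCat.{u}) (Z : SimplexCategoryᵒᵖ ⥤ Type u) {T : Type u} {E : T → Type u}
  [∀ t, SmallCategory (E t)]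
  (φ : ∀ (t : T) (q : SimplexCategoryᵒᵖ), ComposableArrows (E t) q.unop.len → Z.obj q)
  (hφ : ∀ (t : T) (q q' : SimplexCategoryᵒᵖ) (β : q ⟶ q') (S : ComposableArrows (E t) q.unop.len),
    Z.map β (φ t q S) = φ t q' (restrict β S))

/-- The summand of an element in the free simplicial abelian group with coefficients `A`. -/
noncomputable abbrev ιFree {q : SimplexCategoryᵒᵖ} (z : Z.obj q) :
    A ⟶ (Z ⋙ sigmaConst.obj A).obj q :=
  Sigma.ι (fun _ : Z.obj q => A) z

lemma ιFree_map {q q' : SimplexCategoryᵒᵖ} (β : q ⟶ q') (z : Z.obj q) :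
    ιFree A Z z ≫ (Z ⋙ sigmaConst.obj A).map β = ιFree A Z (Z.map β z) := by
  simp [ιFree, sigmaConst]

lemma free_hom_ext {q : SimplexCategoryᵒᵖ} {X : AddCommGrpCat.{u}}
    {f g : (Z ⋙ sigmaConst.obj A).obj q ⟶ X} (h : ∀ z, ιFree A Z z ≫ f = ιFree A Z z ≫ g) :
    f = g :=
  Sigma.hom_ext (f := fun _ : Z.obj q => A) f g h

/-- The map on chains induced by a map from the nerve of a category. -/
noncomputable def freeMapApp (t : T) (q : SimplexCategoryᵒᵖ) :
    (chains (E t) ((Functor.const _).obj A)).obj q ⟶ (Z ⋙ sigmaConst.obj A).obj q :=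
  Sigma.desc fun S => ιFree A Z (φ t q S)

lemma ιConst_freeMapApp (t : T) (q : SimplexCategoryᵒᵖ) (S : ComposableArrows (E t) q.unop.len) :
    ιConst A q S ≫ freeMapApp A Z φ t q = ιFree A Z (φ t q S) :=
  Sigma.ι_desc _ _

/-- The simplicial map on chains induced by a map from the nerve of a category. -/
noncomputable def freeMap (t : T) :
    chains (E t) ((Functor.const _).obj A) ⟶ Z ⋙ sigmaConst.obj A where
  app q := freeMapApp A Z φ t q
  naturality q q' β := constChains_hom_ext fun S => by
    rw [← Category.assoc, ιConst_map, ιConst_freeMapApp, ← Category.assoc, ιConst_freeMapApp,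
      ιFree_map, hφ]

/-- The map of chain complexes induced by a map from the nerve of a category. -/
noncomputable def freeComplexMap (t : T) :
    chainComplex (E t) ((Functor.const _).obj A) ⟶
      (AlgebraicTopology.alternatingFaceMapComplex AddCommGrpCat.{u}).obj (Z ⋙ sigmaConst.obj A) :=
  (AlgebraicTopology.alternatingFaceMapComplex AddCommGrpCat.{u}).map (freeMap A Z φ hφ t)

variable {φ}

/-- If a simplicial set is the disjoint union of the nerves of categories, then its chains are
the coproduct of the chains of these categories. -/
noncomputable def isColimitFreeMapApp (q : SimplexCategoryᵒᵖ)
    (hb : Function.Bijective fun x : Σ t, ComposableArrows (E t) q.unop.len => φ x.1 q x.2) :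
    IsColimit (Cofan.mk ((Z ⋙ sigmaConst.obj A).obj q) fun t => freeMapApp A Z φ t q) := by
  have h (t : T) (S : ComposableArrows (E t) q.unop.len) :
      (Equiv.ofBijective _ hb).symm (φ t q S) = ⟨t, S⟩ :=
    (Equiv.ofBijective _ hb).symm_apply_apply ⟨t, S⟩
  have hfac (s : Cofan fun t => (chains (E t) ((Functor.const _).obj A)).obj q) (t : T)
      (S : ComposableArrows (E t) q.unop.len) : ιFree A Z (φ t q S) ≫
        (Sigma.desc fun z => ιConst A q ((Equiv.ofBijective _ hb).symm z).2 ≫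
          s.inj ((Equiv.ofBijective _ hb).symm z).1) = ιConst A q S ≫ s.inj t := by
    refine (Sigma.ι_desc _ _).trans ?_
    rw [h]
  refine Cofan.IsColimit.mk _
    (fun s => Sigma.desc fun z => ιConst A q ((Equiv.ofBijective _ hb).symm z).2 ≫
      s.inj ((Equiv.ofBijective _ hb).symm z).1)
    (fun s t => constChains_hom_ext fun S => ?_) (fun s m hm => free_hom_ext A Z fun z => ?_)
  · rw [← hfac, ← Category.assoc]
    exact congrArg (· ≫ _) (ιConst_freeMapApp A Z φ t q S)
  · obtain ⟨⟨t, S⟩, rfl⟩ := hb.2 z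
    refine Eq.trans ?_ (hfac s t S).symm
    rw [← hm t, ← Category.assoc]
    exact congrArg (· ≫ m) (ιConst_freeMapApp A Z φ t q S).symm

lemma isIso_desc_homologyMap_freeComplexMap
    (hb : ∀ q : SimplexCategoryᵒᵖ,
      Function.Bijective fun x : Σ t, ComposableArrows (E t) q.unop.len => φ x.1 q x.2) (n : ℕ) :
    IsIso (Sigma.desc fun t => HomologicalComplex.homologyMap (freeComplexMap A Z φ hφ t) n) :=
  AbComplex.isIso_desc_homologyMap _ (fun m => isColimitFreeMapApp A Z (op (SimplexCategory.mk m))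
    (hb _)) n

/-- This identifies how the simplicial operators in the other direction act on the decomposition: it
suffices that `f` sends the string `S` of the summand `t` to the string `S ⋙ Φ` of the summand `t'`.
-/
lemma freeComplexMap_naturality {Z Z' : SimplexCategoryᵒᵖ ⥤ Type u} (f : Z ⟶ Z')
    {T' : Type u} {E' : T' → Type u} [∀ t, SmallCategory (E' t)]
    {φ : ∀ (t : T) (q : SimplexCategoryᵒᵖ), ComposableArrows (E t) q.unop.len → Z.obj q}
    (hφ : ∀ (t : T) (q q' : SimplexCategoryᵒᵖ) (β : q ⟶ q')
      (S : ComposableArrows (E t) q.unop.len), Z.map β (φ t q S) = φ t q' (restrict β S))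
    {φ' : ∀ (t : T') (q : SimplexCategoryᵒᵖ), ComposableArrows (E' t) q.unop.len → Z'.obj q}
    (hφ' : ∀ (t : T') (q q' : SimplexCategoryᵒᵖ) (β : q ⟶ q')
      (S : ComposableArrows (E' t) q.unop.len), Z'.map β (φ' t q S) = φ' t q' (restrict β S))
    {t : T} {t' : T'} (Φ : E t ⥤ E' t')
    (h : ∀ (q : SimplexCategoryᵒᵖ) (S : ComposableArrows (E t) q.unop.len),
      f.app q (φ t q S) = φ' t' q (S ⋙ Φ)) :
    (AlgebraicTopology.alternatingFaceMapComplex _).map (chainsMap A Φ) ≫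
        freeComplexMap A Z' φ' hφ' t' =
      freeComplexMap A Z φ hφ t ≫ (AlgebraicTopology.alternatingFaceMapComplex _).map
        (Functor.whiskerRight f (sigmaConst.obj A)) := by
  have key : chainsMap A Φ ≫ freeMap A Z' φ' hφ' t' =
      freeMap A Z φ hφ t ≫ Functor.whiskerRight f (sigmaConst.obj A) := by
    refine NatTrans.ext (funext fun q => constChains_hom_ext fun S => ?_)
    change ιConst A q S ≫ chainsMapApp A Φ q ≫ freeMapApp A Z' φ' t' q =
      ιConst A q S ≫ freeMapApp A Z φ t q ≫ (sigmaConst.obj A).map (f.app q)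
    rw [← Category.assoc, ιConst_chainsMapApp, ιConst_freeMapApp, ← Category.assoc,
      ιConst_freeMapApp, ← h]
    simp [ιFree, sigmaConst]
  exact ((Functor.map_comp _ _ _).symm.trans (congrArg _ key)).trans (Functor.map_comp _ _ _)

end Decomposition

/-! ### Maps out of the chains of a category. -/

section ChainsDesc

variable {C : Type u} [SmallCategory C] {G : Cᵒᵖ ⥤ AddCommGrpCat.{u}}
  {W : SimplicialObject AddCommGrpCat.{u}}
  (f : ∀ (m : SimplexCategoryᵒᵖ) (σ : ComposableArrows C m.unop.len), coeff G m σ ⟶ W.obj m)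

/-- A morphism from the chains of a category given on the summands of strings. -/
noncomputable def chainsDescApp (m : SimplexCategoryᵒᵖ) : (chains C G).obj m ⟶ W.obj m :=
  Sigma.desc (f m)

lemma ι_chainsDescApp (m : SimplexCategoryᵒᵖ) (σ : ComposableArrows C m.unop.len) :
    Sigma.ι (coeff G m) σ ≫ chainsDescApp f m = f m σ :=
  Sigma.ι_desc _ _

/-- A morphism from the simplicial object of chains of a category given on the summands of
strings. -/
noncomputable def chainsDesc
    (h : ∀ (m m' : SimplexCategoryᵒᵖ) (α : m ⟶ m') (σ : ComposableArrows C m.unop.len),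
      G.map (toLast α σ).op ≫ f m' (restrict α σ) = f m σ ≫ W.map α) :
    chains C G ⟶ W where
  app m := chainsDescApp f m
  naturality m m' α := Sigma.hom_ext (f := coeff G m) _ _ fun σ => by
    have h₁ : Sigma.ι (coeff G m) σ ≫ (chains C G).map α ≫ chainsDescApp f m' =
        G.map (toLast α σ).op ≫ f m' (restrict α σ) := by
      refine (Category.assoc _ _ _).symm.trans
        ((congrArg (· ≫ chainsDescApp f m') (ι_chains_map G α σ)).trans ?_)
      exact (Category.assoc _ _ _).trans
        (congrArg (G.map (toLast α σ).op ≫ ·) (ι_chainsDescApp f m' (restrict α σ)))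
    have h₂ : Sigma.ι (coeff G m) σ ≫ chainsDescApp f m ≫ W.map α = f m σ ≫ W.map α :=
      (Category.assoc _ _ _).symm.trans (congrArg (· ≫ W.map α) (ι_chainsDescApp f m σ))
    exact h₁.trans ((h m m' α σ).trans h₂.symm)

end ChainsDesc

end SmallCat

/-! ### Strings in categories of elements -/

namespace CategoryTheory.CategoryOfElements

open Limits

lemma hom_heq {C : Type*} [Category* C] {F : C ⥤ Type*} {X Y X' Y' : F.Elements} (hX : X = X')
    (hY : Y = Y') (f : X ⟶ Y) (g : X' ⟶ Y') (h : HEq f.val g.val) : HEq f g := by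
  subst hX hY
  exact heq_of_eq (CategoryOfElements.ext F f g (eq_of_heq h))

/-! ### Covariant functors: a string of elements is determined by its first element. -/

section

variable {C : Type*} [Category* C] (F : C ⥤ Type u) {n : ℕ}

/-- The string in the category of elements of a covariant functor with given projection and given
element over the first object. -/
def liftString (τ : ComposableArrows C n) (x : F.obj (τ.obj 0)) :
    ComposableArrows F.Elements n where
  obj i := ⟨τ.obj i, F.map (τ.map (homOfLE (Fin.zero_le i))) x⟩
  map {i j} f := ⟨τ.map f, by
    rw [← ConcreteCategory.comp_apply, ← F.map_comp, ← τ.map_comp]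
    rfl⟩
  map_id i := CategoryOfElements.ext _ _ _ (τ.map_id i)
  map_comp f g := CategoryOfElements.ext _ _ _ (τ.map_comp f g)

lemma liftString_obj_zero_snd (τ : ComposableArrows C n) (x : F.obj (τ.obj 0)) :
    ((liftString F τ x).obj 0).2 = x := by
  change F.map (τ.map (𝟙 _)) x = x
  rw [τ.map_id, F.map_id]
  rfl

/-- Each arrow from the first object carries the first element to the later one, so no other element
is free. -/
lemma liftString_comp_π (S : ComposableArrows F.Elements n) :
    liftString F (S ⋙ CategoryOfElements.π F) (S.obj 0).2 = S := by
  have h (i : Fin (n + 1)) :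
      (liftString F (S ⋙ CategoryOfElements.π F) (S.obj 0).2).obj i = S.obj i :=
    Sigma.ext rfl (heq_of_eq (S.map (homOfLE (Fin.zero_le i))).2)
  exact Functor.hext h fun i j f => hom_heq (h i) (h j) _ _ HEq.rfl

end

/-! ### Contravariant functors: a string of elements is determined by its last element. -/

section

variable {C : Type*} [Category* C] (F : Cᵒᵖ ⥤ Type u) {n : ℕ}

/-- The string in the opposite of the category of elements of a contravariant functor with given
projection and given element over the last object. -/
def liftStringOp (σ : ComposableArrows C n) (x : F.obj (op (σ.obj (Fin.last n)))) :
    ComposableArrows F.Elementsᵒᵖ n where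
  obj i := op ⟨op (σ.obj i), F.map (σ.map (homOfLE (Fin.le_last i))).op x⟩
  map {i j} f := Quiver.Hom.op ⟨(σ.map f).op, by
    rw [← ConcreteCategory.comp_apply, ← F.map_comp, ← op_comp, ← σ.map_comp]
    rfl⟩
  map_id i := congrArg Quiver.Hom.op (CategoryOfElements.ext _ _ _
    (congrArg Quiver.Hom.op (σ.map_id i)))
  map_comp f g := congrArg Quiver.Hom.op (CategoryOfElements.ext _ _ _
    (congrArg Quiver.Hom.op (σ.map_comp f g)))

lemma liftStringOp_congr {σ σ' : ComposableArrows C n} (h : σ = σ')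
    {x : F.obj (op (σ.obj (Fin.last n)))} {x' : F.obj (op (σ'.obj (Fin.last n)))}
    (hx : HEq x x') : liftStringOp F σ x = liftStringOp F σ' x' := by
  subst h
  rw [eq_of_heq hx]

/-- The projection from the opposite of the category of elements of a contravariant functor. -/
def πOp : F.Elementsᵒᵖ ⥤ C := (CategoryOfElements.π F).op ⋙ unopUnop C

lemma liftStringOp_obj_last_snd (σ : ComposableArrows C n) (x : F.obj (op (σ.obj (Fin.last n)))) :
    ((liftStringOp F σ x).obj (Fin.last n)).unop.2 = x := by
  change F.map (σ.map (𝟙 _)).op x = x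
  rw [σ.map_id, op_id, F.map_id]
  rfl

lemma op_heq {C : Type*} [Category* C] {X Y X' Y' : C} (hX : X = X') (hY : Y = Y') (f : X ⟶ Y)
    (g : X' ⟶ Y') (h : HEq f g) : HEq f.op g.op := by
  subst hX hY
  rw [eq_of_heq h]

lemma liftStringOp_comp_πOp (S : ComposableArrows F.Elementsᵒᵖ n) :
    liftStringOp F (S ⋙ πOp F) (S.obj (Fin.last n)).unop.2 = S := by
  have h (i : Fin (n + 1)) :
      ((liftStringOp F (S ⋙ πOp F) (S.obj (Fin.last n)).unop.2).obj i).unop = (S.obj i).unop :=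
    Sigma.ext rfl (heq_of_eq (S.map (homOfLE (Fin.le_last i))).unop.2)
  exact Functor.hext (fun i => congrArg op (h i)) fun i j f =>
    op_heq (h j) (h i) _ _ (hom_heq (h j) (h i) _ (S.map f).unop HEq.rfl)

end

end CategoryTheory.CategoryOfElements

/-! ### The columns of the double complex of a profunctor -/

namespace Het

open Limits CategoryOfElements

variable {C D : Type u} [SmallCategory C] [SmallCategory D] (P : Cᵒᵖ × D ⥤ Type u)
  (A : AddCommGrpCat.{u})

lemma Chain.ext_heq {P : Cᵒᵖ × D ⥤ Type u} {p q : SimplexCategoryᵒᵖ} {x y : Chain P p q}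
    (hl : x.left = y.left) (hr : x.right = y.right) (hh : HEq x.het y.het) : x = y := by
  obtain ⟨σ, τ, φ⟩ := x
  obtain ⟨σ', τ', φ'⟩ := y
  obtain rfl : σ = σ' := hl
  obtain rfl : τ = τ' := hr
  exact congrArg (Chain.mk σ τ) (eq_of_heq hh)

/-- The columns of the double complex, as a simplicial object. -/
noncomputable abbrev columns : SimplicialObject (ChainComplex AddCommGrpCat.{u} ℕ) :=
  bisimplicialSet P ⋙
    (Functor.whiskeringRight SimplexCategoryᵒᵖ _ _).obj (Limits.sigmaConst.obj A) ⋙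
      AlgebraicTopology.alternatingFaceMapComplex AddCommGrpCat.{u}

/-- The presheaf of heteromorphisms from `c`. -/
abbrev hetFrom (c : C) : D ⥤ Type u := (Functor.curry.obj P).obj (op c)

/-- The chain that consists of a string `σ` in `C` and of a string of heteromorphisms from the last
object of `σ`. -/
def chainFrom (p : SimplexCategoryᵒᵖ) (σ : ComposableArrows C p.unop.len) (q : SimplexCategoryᵒᵖ)
    (S : ComposableArrows (hetFrom P (σ.obj (Fin.last _))).Elements q.unop.len) :
    ((bisimplicialSet P).obj p).obj q :=
  (⟨σ, S ⋙ CategoryOfElements.π _, (S.obj 0).2⟩ : Chain P p q)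

/-- Only the heteromorphism needs an argument: composing it with `d_0 ⟶ d_{β 0}` gives the element
over `d_{β 0}`, which is what an arrow of elements asserts. -/
lemma map_chainFrom (p : SimplexCategoryᵒᵖ) (σ : ComposableArrows C p.unop.len)
    (q q' : SimplexCategoryᵒᵖ) (β : q ⟶ q')
    (S : ComposableArrows (hetFrom P (σ.obj (Fin.last _))).Elements q.unop.len) :
    ((bisimplicialSet P).obj p).map β (chainFrom P p σ q S) =
      chainFrom P p σ q' (SmallCat.restrict β S) := by
  refine congrArg (Chain.mk _ _) (Eq.trans (congrArg (fun f => P.map f (S.obj 0).2) ?_)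
    (S.map (homOfLE (Fin.zero_le (β.unop.toOrderHom 0)))).2)
  exact Prod.ext (congrArg Quiver.Hom.op (σ.map_id _)) rfl

lemma chainFrom_bijective (p q : SimplexCategoryᵒᵖ) :
    Function.Bijective fun x : Σ σ : ComposableArrows C p.unop.len,
      ComposableArrows (hetFrom P (σ.obj (Fin.last _))).Elements q.unop.len =>
        chainFrom P p x.1 q x.2 :=
  Function.bijective_iff_has_inverse.2
    ⟨fun x : Chain P p q => ⟨x.left, liftString (hetFrom P _) x.right x.het⟩,
      fun x => congrArg (Sigma.mk x.1) (liftString_comp_π _ x.2),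
      fun x => congrArg (Chain.mk x.left x.right)
        (liftString_obj_zero_snd (hetFrom P _) x.right x.het)⟩

/-- The inclusion of the summand of a string into a column of the double complex. -/
noncomputable def columnι (p : SimplexCategoryᵒᵖ) (σ : ComposableArrows C p.unop.len) :
    SmallCat.chainComplex (hetFrom P (σ.obj (Fin.last _))).Elements ((Functor.const _).obj A) ⟶
      (columns P A).obj p :=
  SmallCat.freeComplexMap A ((bisimplicialSet P).obj p) (chainFrom P p) (map_chainFrom P p) σ

/-- Restriction along `α` precomposes the heteromorphism with `toLast α σ`. This is the functor
between categories of heteromorphisms that induces the coefficient map of `coeffC`. -/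
lemma map_columnι {p p' : SimplexCategoryᵒᵖ} (α : p ⟶ p') (σ : ComposableArrows C p.unop.len) :
    (SmallCat.constChainComplex A).map (Functor.elementsFunctor.map
      ((Functor.curry.obj P).map (SmallCat.toLast α σ).op)) ≫
        columnι P A p' (SmallCat.restrict α σ) = columnι P A p σ ≫ (columns P A).map α := by
  refine SmallCat.freeComplexMap_naturality A ((bisimplicialSet P).map α)
    (map_chainFrom P p) (map_chainFrom P p')
    (NatTrans.mapElements ((Functor.curry.obj P).map (SmallCat.toLast α σ).op)) fun q S => ?_
  refine congrArg (Chain.mk _ _) (congrArg (fun f => P.map f (S.obj 0).2) ?_)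
  exact Prod.ext rfl ((S ⋙ CategoryOfElements.π _).map_id _)

/-- The map from the direct sum of the homology groups of the categories of heteromorphisms with
fixed domain to the homology of the columns of the double complex. -/
noncomputable def chainsToColumns (q : ℕ) :
    SmallCat.chains C (coeffC P A q) ⟶ columns P A ⋙ HomologicalComplex.homologyFunctor _ _ q :=
  SmallCat.chainsDesc (fun p σ => HomologicalComplex.homologyMap (columnι P A p σ) q)
    fun p p' α σ => by
      refine (HomologicalComplex.homologyMap_comp _ _ _).symm.trans (Eq.trans ?_
        (HomologicalComplex.homologyMap_comp _ _ _))
      exact congrArg (HomologicalComplex.homologyMap · q) (map_columnι P A α σ)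

instance isIso_chainsToColumns (q : ℕ) : IsIso (chainsToColumns P A q) :=
  (NatTrans.isIso_iff_isIso_app _).2 fun p =>
    SmallCat.isIso_desc_homologyMap_freeComplexMap A ((bisimplicialSet P).obj p)
      (map_chainFrom P p) (chainFrom_bijective P p) q

/-- The second page for the first filtration in terms of the homology of small categories. -/
noncomputable def columnHomologyIso (p q : ℕ) :
    (DoubleComplex.columnHomology (doubleComplex P A) q).homology p ≅
      SmallCat.homology C (coeffC P A q) p :=
  (HomologicalComplex.homologyFunctor _ _ p).mapIso
    -- Homology is additive, so it commutes with the formation of alternating sums of faces.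
    ((eqToIso (Functor.congr_obj (AlgebraicTopology.map_alternatingFaceMapComplex
      (HomologicalComplex.homologyFunctor AddCommGrpCat.{u} (ComplexShape.down ℕ) q))
      (columns P A))).trans
    ((AlgebraicTopology.alternatingFaceMapComplex _).mapIso
      (asIso (chainsToColumns P A q)).symm))

end Het

/-! ### Reversal of simplicial objects -/

namespace AlgebraicTopology

open Simplicial

section

variable {V : Type*} [Category* V] [Preadditive V]

/-- The sign of the reversal of the `n + 1` vertices of an `n`-simplex. -/
def reversalSign (n : ℕ) : ℤ := ∏ i ∈ Finset.range (n + 1), (-1) ^ i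

lemma reversalSign_succ (n : ℕ) : reversalSign (n + 1) = reversalSign n * (-1) ^ (n + 1) :=
  Finset.prod_range_succ _ _

lemma reversalSign_mul_self (n : ℕ) : reversalSign n * reversalSign n = 1 := by
  rw [reversalSign, ← Finset.prod_mul_distrib]
  exact Finset.prod_eq_one fun i _ => by rw [← mul_pow]; simp

lemma reversalSign_zsmul_comp_self (X : V) (n : ℕ) :
    (reversalSign n • 𝟙 X) ≫ (reversalSign n • 𝟙 X) = 𝟙 X := by
  rw [Preadditive.zsmul_comp, Preadditive.comp_zsmul, Category.id_comp, smul_smul,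
    reversalSign_mul_self, one_smul]

/-- Reversal turns the face `i` into the face `n + 1 - i`. The signs of these differ by `(-1)^{n+1}`
for every `i`, and this is the ratio of consecutive values of `reversalSign`. -/
lemma reversalSign_zsmul_objD (Y : SimplicialObject V) (n : ℕ) :
    reversalSign (n + 1) • AlternatingFaceMapComplex.objD Y n =
      reversalSign n • AlternatingFaceMapComplex.objD (SimplexCategory.rev.op ⋙ Y) n := by
  have h (i : Fin (n + 2)) : SimplicialObject.δ (SimplexCategory.rev.op ⋙ Y) i = Y.δ i.rev :=
    congrArg (fun f => Y.map (Quiver.Hom.op f)) (SimplexCategory.rev_map_δ i)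
  have e : AlternatingFaceMapComplex.objD (SimplexCategory.rev.op ⋙ Y) n =
      ∑ i : Fin (n + 2), (-1 : ℤ) ^ (i.rev : ℕ) • Y.δ i :=
    (Finset.sum_congr rfl fun i _ => congrArg (((-1 : ℤ) ^ i.val) • ·) (h i)).trans
      (Fintype.sum_equiv Fin.revPerm _ _ fun i => by simp)
  rw [e, AlternatingFaceMapComplex.objD, Finset.smul_sum, Finset.smul_sum]
  refine Finset.sum_congr rfl fun i _ => ?_
  rw [smul_smul, smul_smul, reversalSign_succ, mul_assoc, ← pow_add]
  congr 2
  rw [neg_one_pow_eq_pow_mod_two, neg_one_pow_eq_pow_mod_two (n := (i.rev : ℕ)), Fin.val_rev]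
  congr 1
  have := i.isLt
  lia

/-- The alternating face map complex of a simplicial object and of its reversal are isomorphic. -/
noncomputable def alternatingFaceMapComplexRevIso (Y : SimplicialObject V) :
    (alternatingFaceMapComplex V).obj (SimplexCategory.rev.op ⋙ Y) ≅
      (alternatingFaceMapComplex V).obj Y :=
  HomologicalComplex.Hom.isoOfComponents
    (fun n =>
      { hom := reversalSign n • 𝟙 (Y.obj (op ⦋n⦌))
        inv := reversalSign n • 𝟙 (Y.obj (op ⦋n⦌))
        hom_inv_id := reversalSign_zsmul_comp_self _ n
        inv_hom_id := reversalSign_zsmul_comp_self _ n })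
    fun i j hij => by
      obtain rfl : j + 1 = i := hij
      rw [alternatingFaceMapComplex_obj_d, alternatingFaceMapComplex_obj_d]
      refine (Preadditive.zsmul_comp _ _ _).trans (Eq.trans ?_ (Preadditive.comp_zsmul _ _ _).symm)
      refine (congrArg (reversalSign (j + 1) • ·) (Category.id_comp _)).trans (Eq.trans ?_
        (congrArg (reversalSign j • ·) (Category.comp_id _)).symm)
      exact reversalSign_zsmul_objD Y j

end

end AlgebraicTopology

/-! ### Reversal of strings -/

namespace SmallCat

lemma map_heq {I D : Type*} [Preorder I] [Category* D] (F : I ⥤ D) {i j i' j' : I} (hi : i = i')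
    (hj : j = j') (f : i ⟶ j) (f' : i' ⟶ j') : HEq (F.map f) (F.map f') := by
  subst hi hj
  exact heq_of_eq (congrArg F.map (Subsingleton.elim f f'))

lemma unop_heq {D : Type*} [Category* D] {X Y X' Y' : Dᵒᵖ} (hX : X = X') (hY : Y = Y')
    {f : X ⟶ Y} {g : X' ⟶ Y'} (h : HEq f g) : HEq f.unop g.unop := by
  subst hX hY
  rw [eq_of_heq h]

variable {D : Type u} [SmallCategory D]

/-- The string in a category that is obtained from a string in the opposite category by
reversal. -/
def reverse {n : ℕ} (ρ : ComposableArrows Dᵒᵖ n) : ComposableArrows D n where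
  obj i := (ρ.obj i.rev).unop
  map f := (ρ.map (homOfLE (Fin.rev_le_rev.2 (leOfHom f)))).unop
  map_id _ := congrArg Quiver.Hom.unop (ρ.map_id _)
  map_comp f g := congrArg Quiver.Hom.unop
    (ρ.map_comp (homOfLE (Fin.rev_le_rev.2 (leOfHom g))) (homOfLE (Fin.rev_le_rev.2 (leOfHom f))))

/-- The string in the opposite category that is obtained from a string by reversal. -/
def reverseOp {n : ℕ} (τ : ComposableArrows D n) : ComposableArrows Dᵒᵖ n where
  obj i := op (τ.obj i.rev)
  map f := (τ.map (homOfLE (Fin.rev_le_rev.2 (leOfHom f)))).op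
  map_id _ := congrArg Quiver.Hom.op (τ.map_id _)
  map_comp f g := congrArg Quiver.Hom.op
    (τ.map_comp (homOfLE (Fin.rev_le_rev.2 (leOfHom g))) (homOfLE (Fin.rev_le_rev.2 (leOfHom f))))

lemma reverse_reverseOp {n : ℕ} (τ : ComposableArrows D n) : reverse (reverseOp τ) = τ :=
  Functor.hext (fun _ => congrArg τ.obj (Fin.rev_rev _)) fun _ _ f =>
    map_heq τ (Fin.rev_rev _) (Fin.rev_rev _) (homOfLE _) f

lemma reverseOp_reverse {n : ℕ} (ρ : ComposableArrows Dᵒᵖ n) : reverseOp (reverse ρ) = ρ :=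
  Functor.hext (fun _ => congrArg ρ.obj (Fin.rev_rev _)) fun _ _ f =>
    map_heq ρ (Fin.rev_rev _) (Fin.rev_rev _) (homOfLE _) f

/-- Reversing positions before and after `α` conjugates the operator; the two inner reversals
cancel. -/
lemma restrict_reverse {m m' : SimplexCategoryᵒᵖ} (α : m ⟶ m')
    (ρ : ComposableArrows Dᵒᵖ m.unop.len) :
    restrict (SimplexCategory.rev.op.map α) (reverse ρ) = reverse (restrict α ρ) :=
  Functor.hext (fun _ => congrArg (fun i => (ρ.obj i).unop) (Fin.rev_rev _)) fun _ _ _ =>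
    unop_heq (congrArg ρ.obj (Fin.rev_rev _)) (congrArg ρ.obj (Fin.rev_rev _))
      (map_heq ρ (Fin.rev_rev _) (Fin.rev_rev _) (homOfLE _) (homOfLE _))

end SmallCat

/-! ### The rows of the double complex of a profunctor -/

namespace Het

open Limits CategoryOfElements

variable {C D : Type u} [SmallCategory C] [SmallCategory D] (P : Cᵒᵖ × D ⥤ Type u)
  (A : AddCommGrpCat.{u})

/-- The rows of the double complex, as a simplicial object. -/
noncomputable abbrev rows : SimplicialObject (ChainComplex AddCommGrpCat.{u} ℕ) :=
  (bisimplicialSet P).flip ⋙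
    (Functor.whiskeringRight SimplexCategoryᵒᵖ _ _).obj (Limits.sigmaConst.obj A) ⋙
      AlgebraicTopology.alternatingFaceMapComplex AddCommGrpCat.{u}

/-- Evaluation in degree `k` is additive. This compares the outer differential of a double complex
with the inner differential of its flip. -/
lemma alternatingFaceMapComplex_d_f (X : SimplicialObject (ChainComplex AddCommGrpCat.{u} ℕ))
    (n k : ℕ) :
    (((AlgebraicTopology.alternatingFaceMapComplex _).obj X).d (n + 1) n).f k =
      ∑ i : Fin (n + 2), ((-1 : ℤ) ^ i.val) • (X.δ i).f k := by
  rw [AlgebraicTopology.alternatingFaceMapComplex_obj_d,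
    AlgebraicTopology.AlternatingFaceMapComplex.objD]
  exact map_sum (AddMonoidHom.mk' (fun f : X.obj _ ⟶ X.obj _ => f.f k)
    fun _ _ => rfl) _ _

/-- The alternating face map complex of the rows is the flipped double complex. -/
noncomputable def flipIso : (doubleComplex P A).flip ≅
    (AlgebraicTopology.alternatingFaceMapComplex _).obj (rows P A) :=
  HomologicalComplex.Hom.isoOfComponents
    (fun q => HomologicalComplex.Hom.isoOfComponents (fun p => Iso.refl _) fun p p' h => by
      obtain rfl : p' + 1 = p := h
      refine (Category.id_comp _).trans (Eq.trans ?_ (Category.comp_id _).symm)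
      exact (AlgebraicTopology.AlternatingFaceMapComplex.obj_d_eq _ p').trans
        (alternatingFaceMapComplex_d_f (columns P A) p' q).symm)
    fun q q' h => by
      obtain rfl : q' + 1 = q := h
      ext p : 1
      refine (Category.id_comp _).trans (Eq.trans ?_ (Category.comp_id _).symm)
      exact (alternatingFaceMapComplex_d_f (rows P A) q' p).trans
        (AlgebraicTopology.AlternatingFaceMapComplex.obj_d_eq ((bisimplicialSet P).obj
          (op (SimplexCategory.mk p)) ⋙ sigmaConst.obj A) q').symm

/-- The presheaf of heteromorphisms to `d`. -/
abbrev hetTo (d : D) : Cᵒᵖ ⥤ Type u := (Functor.curry.obj P).flip.obj d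

/-- The chain that consists of the reversal of a string `ρ` in `Dᵒᵖ` and of a string of
heteromorphisms to the last object of `ρ`. -/
def chainTo (q : SimplexCategoryᵒᵖ) (ρ : ComposableArrows Dᵒᵖ q.unop.len) (p : SimplexCategoryᵒᵖ)
    (S : ComposableArrows (hetTo P (ρ.obj (Fin.last _)).unop).Elementsᵒᵖ p.unop.len) :
    ((bisimplicialSet P).flip.obj (SimplexCategory.rev.op.obj q)).obj p :=
  (⟨S ⋙ πOp _, SmallCat.reverse ρ, (S.obj (Fin.last _)).unop.2⟩ : Chain P p q)

lemma map_chainTo (q : SimplexCategoryᵒᵖ) (ρ : ComposableArrows Dᵒᵖ q.unop.len)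
    (p p' : SimplexCategoryᵒᵖ) (α : p ⟶ p')
    (S : ComposableArrows (hetTo P (ρ.obj (Fin.last _)).unop).Elementsᵒᵖ p.unop.len) :
    ((bisimplicialSet P).flip.obj (SimplexCategory.rev.op.obj q)).map α (chainTo P q ρ p S) =
      chainTo P q ρ p' (SmallCat.restrict α S) := by
  refine congrArg (Chain.mk _ _) (Eq.trans
    (congrArg (fun f => P.map f (S.obj (Fin.last _)).unop.2) ?_)
    (S.map (homOfLE (Fin.le_last (α.unop.toOrderHom (Fin.last _))))).unop.2)
  exact Prod.ext rfl ((SmallCat.reverse ρ).map_id _)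

lemma Chain.het_heq {P : Cᵒᵖ × D ⥤ Type u} {p q : SimplexCategoryᵒᵖ} {x y : Chain P p q}
    (h : x = y) : HEq x.het y.het := by
  rw [h]

lemma chainTo_bijective (q p : SimplexCategoryᵒᵖ) :
    Function.Bijective fun x : Σ ρ : ComposableArrows Dᵒᵖ q.unop.len,
      ComposableArrows (hetTo P (ρ.obj (Fin.last _)).unop).Elementsᵒᵖ p.unop.len =>
        chainTo P q x.1 p x.2 := by
  constructor
  · rintro ⟨ρ, S⟩ ⟨ρ', S'⟩ h
    have h : (⟨S ⋙ πOp _, SmallCat.reverse ρ, (S.obj (Fin.last _)).unop.2⟩ : Chain P p q) =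
        ⟨S' ⋙ πOp _, SmallCat.reverse ρ', (S'.obj (Fin.last _)).unop.2⟩ := h
    -- The string in `D` determines `ρ` by reversal. Once `ρ` is fixed, the remaining data determine
    -- `S` from its projection and last element.
    obtain rfl : ρ = ρ' := (SmallCat.reverseOp_reverse ρ).symm.trans
      ((congrArg (fun x : Chain P p q => SmallCat.reverseOp x.right) h).trans
        (SmallCat.reverseOp_reverse ρ'))
    refine congrArg (Sigma.mk ρ) ?_
    rw [← liftStringOp_comp_πOp _ S, ← liftStringOp_comp_πOp _ S']
    exact liftStringOp_congr _ (congrArg Chain.left h) (Chain.het_heq h)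
  · intro x
    obtain ⟨σ, τ, φ⟩ : Chain P p q := x
    obtain ⟨ρ, rfl⟩ : ∃ ρ, SmallCat.reverse ρ = τ := ⟨_, SmallCat.reverse_reverseOp τ⟩
    exact ⟨⟨ρ, liftStringOp (hetTo P _) σ φ⟩, congrArg (Chain.mk σ (SmallCat.reverse ρ))
      (liftStringOp_obj_last_snd (hetTo P _) σ φ)⟩

/-- The inclusion of the summand of a string into a row of the double complex. -/
noncomputable def rowι (q : SimplexCategoryᵒᵖ) (ρ : ComposableArrows Dᵒᵖ q.unop.len) :
    SmallCat.chainComplex (hetTo P (ρ.obj (Fin.last _)).unop).Elementsᵒᵖ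
      ((Functor.const _).obj A) ⟶ (SimplexCategory.rev.op ⋙ rows P A).obj q :=
  SmallCat.freeComplexMap A ((bisimplicialSet P).flip.obj (SimplexCategory.rev.op.obj q))
    (chainTo P q) (map_chainTo P q) ρ

lemma map_heq_of_heq {c c' : Cᵒᵖ} {d d₁ d₂ : D} (x : P.obj (c, d)) (hd : d₁ = d₂)
    {f f' : c ⟶ c'} (hf : f = f') {g : d ⟶ d₁} {g' : d ⟶ d₂} (hg : HEq g g') :
    HEq (P.map (Prod.mkHom f g) x) (P.map (Prod.mkHom f' g') x) := by
  subst hd hf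
  rw [eq_of_heq hg]

/-- The last object of `ρ` is the first object of its reversal, so `toLast β ρ` read in `D` is the
arrow out of `d_0` with which the restricted chain composes its heteromorphism. -/
lemma map_rowι {q q' : SimplexCategoryᵒᵖ} (β : q ⟶ q') (ρ : ComposableArrows Dᵒᵖ q.unop.len) :
    (SmallCat.constChainComplex A).map (Cat.opFunctor.map (Functor.elementsFunctor.map
      ((Functor.curry.obj P).flip.map (SmallCat.toLast β ρ).unop))) ≫
        rowι P A q' (SmallCat.restrict β ρ) =
      rowι P A q ρ ≫ (SimplexCategory.rev.op ⋙ rows P A).map β := by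
  refine SmallCat.freeComplexMap_naturality A
    ((bisimplicialSet P).flip.map (SimplexCategory.rev.op.map β))
    (map_chainTo P q) (map_chainTo P q')
    (NatTrans.mapElements ((Functor.curry.obj P).flip.map (SmallCat.toLast β ρ).unop)).op
    fun p S => ?_
  refine Chain.ext_heq rfl (SmallCat.restrict_reverse β ρ) ?_
  exact map_heq_of_heq P _ (congrArg (fun i => (ρ.obj i).unop) (Fin.rev_rev _))
    (congrArg Quiver.Hom.op ((S ⋙ πOp _).map_id _))
    (SmallCat.unop_heq (congrArg ρ.obj (Fin.rev_rev _)) rfl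
      (SmallCat.map_heq ρ (Fin.rev_rev _) rfl (homOfLE _) (homOfLE _)))

/-- The map from the direct sum of the homology groups of the categories of heteromorphisms with
fixed codomain to the homology of the rows of the double complex. -/
noncomputable def chainsToRows (p : ℕ) :
    SmallCat.chains Dᵒᵖ (unopUnop D ⋙ coeffD P A p) ⟶
      SimplexCategory.rev.op ⋙ rows P A ⋙ HomologicalComplex.homologyFunctor _ _ p :=
  SmallCat.chainsDesc (fun q ρ => HomologicalComplex.homologyMap (rowι P A q ρ) p)
    fun q q' β ρ => by
      refine (HomologicalComplex.homologyMap_comp _ _ _).symm.trans (Eq.trans ?_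
        (HomologicalComplex.homologyMap_comp _ _ _))
      exact congrArg (HomologicalComplex.homologyMap · p) (map_rowι P A β ρ)

instance isIso_chainsToRows (p : ℕ) : IsIso (chainsToRows P A p) :=
  (NatTrans.isIso_iff_isIso_app _).2 fun q =>
    SmallCat.isIso_desc_homologyMap_freeComplexMap A
      ((bisimplicialSet P).flip.obj (SimplexCategory.rev.op.obj q))
      (map_chainTo P q) (chainTo_bijective P q) p

/-- The second page for the second filtration in terms of the homology of small categories. -/
noncomputable def rowHomologyIso (p q : ℕ) :
    (DoubleComplex.columnHomology (doubleComplex P A).flip p).homology q ≅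
      SmallCat.homology Dᵒᵖ (unopUnop D ⋙ coeffD P A p) q :=
  (HomologicalComplex.homologyFunctor _ _ q).mapIso
    ((((HomologicalComplex.homologyFunctor AddCommGrpCat.{u} (ComplexShape.down ℕ)
        p).mapHomologicalComplex (ComplexShape.down ℕ)).mapIso (flipIso P A)).trans
    ((eqToIso (Functor.congr_obj (AlgebraicTopology.map_alternatingFaceMapComplex
      (HomologicalComplex.homologyFunctor AddCommGrpCat.{u} (ComplexShape.down ℕ) p))
      (rows P A))).trans
    -- The rows are replaced by their reversal, since the chains of `Dᵒᵖ` map to the reversed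
    -- simplicial object.
    ((AlgebraicTopology.alternatingFaceMapComplexRevIso _).symm.trans
    ((AlgebraicTopology.alternatingFaceMapComplex _).mapIso
      (asIso (chainsToRows P A p)).symm))))

end Het

/-! ### The two spectral sequences of a profunctor -/

lemma FilteredComplex.isBidegree_fst_snd : FilteredComplex.IsBidegree
    (fun r => ComplexShape.spectralSequenceNat (-r, r - 1)) Prod.fst Prod.snd where
  add a := rfl
  rel_iff r a b := by
    rw [ComplexShape.spectralSequenceNat_rel_iff]
    lia
  exists_eq i j := ⟨(i, j), rfl, rfl⟩

lemma FilteredComplex.isBidegree_snd_fst : FilteredComplex.IsBidegree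
    (fun r => ComplexShape.spectralSequenceNat (r - 1, -r)) Prod.snd Prod.fst where
  add a := add_comm _ _
  rel_iff r a b := by
    rw [ComplexShape.spectralSequenceNat_rel_iff]
    lia
  exists_eq i j := ⟨(j, i), rfl, rfl⟩

theorem theorem5p3 {C D : Type u} [SmallCategory C] [SmallCategory D]
    (P : Cᵒᵖ × D ⥤ Type u) (A : AddCommGrpCat.{u}) :
    ∃ (EC : SpectralSequence AddCommGrpCat.{u}
          (fun r => ComplexShape.spectralSequenceNat (-r, r - 1)) 0)
      (ED : SpectralSequence AddCommGrpCat.{u}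
          (fun r => ComplexShape.spectralSequenceNat (r - 1, -r)) 0),
      -- both arise from the double complex of chains, by its two filtrations
      Nonempty (FilteredComplex.Presentation EC Prod.fst (DoubleComplex.tot (Het.doubleComplex P A))
        (DoubleComplex.filtration₁ (Het.doubleComplex P A))) ∧
      Nonempty (FilteredComplex.Presentation ED Prod.snd (DoubleComplex.tot (Het.doubleComplex P A))
        (DoubleComplex.filtration₂ (Het.doubleComplex P A))) ∧
      -- the second pages
      (∀ p q : ℕ, Nonempty ((EC.page 2).X (p, q) ≅ SmallCat.homology C (Het.coeffC P A q) p)) ∧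
      (∀ p q : ℕ, Nonempty ((ED.page 2).X (p, q) ≅
        SmallCat.homology Dᵒᵖ (unopUnop D ⋙ Het.coeffD P A p) q)) ∧
      -- both converge to the homology of the total complex
      FilteredComplex.ConvergesTo EC Prod.fst
        (fun n => (DoubleComplex.tot (Het.doubleComplex P A)).homology n)
        (FilteredComplex.homologyFiltration _ (DoubleComplex.filtration₁ (Het.doubleComplex P A))) ∧
      FilteredComplex.ConvergesTo ED Prod.snd
        (fun n => (DoubleComplex.tot (Het.doubleComplex P A)).homology n)
        (FilteredComplex.homologyFiltration _
          (DoubleComplex.filtration₂ (Het.doubleComplex P A))) := by 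
  refine ⟨FilteredComplex.spectralSequence
      (DoubleComplex.filtration₁_isFirstQuadrant (Het.doubleComplex P A))
      FilteredComplex.isBidegree_fst_snd,
    FilteredComplex.spectralSequence
      (DoubleComplex.filtration₂_isFirstQuadrant (Het.doubleComplex P A))
      FilteredComplex.isBidegree_snd_fst,
    ⟨FilteredComplex.presentation _ _⟩, ⟨FilteredComplex.presentation _ _⟩,
    fun p q => ⟨(AddEquiv.toAddCommGrpIso (DoubleComplex.secondPageEquiv _ p q (p + q) rfl)).trans
      (Het.columnHomologyIso P A p q)⟩,
    fun p q => ⟨(AddEquiv.toAddCommGrpIso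
      (DoubleComplex.secondPageEquivFlip _ p q (p + q) rfl)).trans (Het.rowHomologyIso P A p q)⟩,
    FilteredComplex.spectralSequence_convergesTo _ _ fun _ => ⟨le_max_left _ _, le_max_right _ _⟩,
    FilteredComplex.spectralSequence_convergesTo _ _ fun _ => ⟨le_max_right _ _, le_max_left _ _⟩⟩
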